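/- Let $\mathcal B$ be the braid category: its objects are the natural numbers, $\mathcal B(n,n)=B_n$ is the braid group on $n$ strands and $\mathcal B(n,m)=\emptyset$ for $n\ne m$. It is a strict monoidal category with $m\otimes n=m+n$ and juxtaposition of braids, and it is braided, the braiding $\gamma_{m,n}:m\otimes n\to n\otimes m$ being the braid that passes a block of $n$ strands across a block of $m$ strands. There is a tricategory $T$ (in the sense of Gordon, Power and Street) with one 0-cell and one 1-cell, whose 2-cells are the natural numbers and whose 3-cells $n\to m$ are the elements of $\mathcal B(n,m)$, composed as in $\mathcal B$, such that composition along 1-cells is $\otimes$, and composition along 0-cells is the homomorphism (pseudofunctor) of two variables given by $\otimes$ on 2-cells and 3-cells, with the interchange constraint $$(X_1\otimes X_2)\otimes(Y_1\otimes Y_2)\;\cong\;(X_1\otimes Y_1)\otimes(X_2\otimes Y_2)$$ given by $1\otimes\gamma_{X_2,Y_1}\otimes 1$. This $T$ is a Gray-category: everything in it except interchange is strict (its hom-bicategory is a 2-category, composition along 0-cells is a cubical functor, and the units and all associativity and unit constraints, including the four constraint modifications, are identities). Furthermore, $T$ is not a Penon 3-category in the following sense. Let $\mathcal Q_3$ be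 the category whose objects are maps of magmas $f:A\to B$, where $A$ is a 3-dimensional reflexive globular set with binary compositions, $B$ is a strict 3-category and $f$ is equipped with a contraction: for $m<3$ and parallel $m$-cells $x,y$ of $A$ with $f(x)=f(y)$ a chosen $(m+1)$-cell $[x,y]:x\to y$ with $f([x,y])=1_{f(x)}$ and $[x,x]=1_x$, while parallel 3-cells with the same image under $f$ are equal. Let $P_3$ be the monad on 3-dimensional reflexive globular sets induced by the forgetful functor $(f:A\to B)\mapsto A$ and its left adjoint; a Penon 3-category is a $P_3$-algebra $\theta:P_3X\to X$, with composition $y\circ_k x=\theta(\eta y\circ_k\eta x)$. Then there is no Penon 3-category $X$ with an isomorphism of reflexive globular sets from the underlying reflexive globular set of $T$ to $X$ that carries the composition of 2-cells along 1-cells, of 3-cells along 2-cells and of 3-cells along 1-cells in $T$ to the corresponding compositions in $X$. Hence there are tricategories that are not Penon 3-categories. -/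

import Mathlib

open CategoryTheory

namespace Penon

universe u

/-- An `n`-dimensional reflexive globular set: sets of `m`-cells (none for `m > n`), source and
target maps, and identities `i` in dimensions below `n`. -/
structure RGSet (n : ℕ) where
  cells : ℕ → Type u
  isEmpty_cells : ∀ {m : ℕ}, n < m → IsEmpty (cells m)
  s : ∀ {m : ℕ}, cells (m + 1) → cells m
  t : ∀ {m : ℕ}, cells (m + 1) → cells m
  i : ∀ {m : ℕ}, m < n → cells m → cells (m + 1)
  s_s : ∀ {m : ℕ} (x : cells (m + 2)), s (s x) = s (t x)
  t_s : ∀ {m : ℕ} (x : cells (m + 2)), t (s x) = t (t x)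
  s_i : ∀ {m : ℕ} (h : m < n) (x : cells m), s (i h x) = x
  t_i : ∀ {m : ℕ} (h : m < n) (x : cells m), t (i h x) = x

namespace RGSet

variable {n : ℕ}

/-- Maps of reflexive globular sets. -/
@[ext]
structure Hom (A B : RGSet.{u} n) where
  map : ∀ {m : ℕ}, A.cells m → B.cells m
  map_s : ∀ {m : ℕ} (x : A.cells (m + 1)), map (A.s x) = B.s (map x)
  map_t : ∀ {m : ℕ} (x : A.cells (m + 1)), map (A.t x) = B.t (map x)
  map_i : ∀ {m : ℕ} (h : m < n) (x : A.cells m), map (A.i h x) = B.i h (map x)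

instance : Category (RGSet.{u} n) where
  Hom := Hom
  id A :=
    { map := fun x => x
      map_s := fun _ => rfl
      map_t := fun _ => rfl
      map_i := fun _ _ => rfl }
  comp f g :=
    { map := fun x => g.map (f.map x)
      map_s := fun x => by rw [f.map_s, g.map_s]
      map_t := fun x => by rw [f.map_t, g.map_t]
      map_i := fun h x => by rw [f.map_i, g.map_i] }

/-- `A.Composable k m y x` says that the `m`-cells `x` and `y` match along `k`-cells, that is,
`k < m` and `t ^ (m - k) x = s ^ (m - k) y`. -/
def Composable (A : RGSet.{u} n) (k : ℕ) : ∀ m : ℕ, A.cells m → A.cells m → Prop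
  | 0, _, _ => False
  | m + 1, y, x => if k = m then A.t x = A.s y else Composable A k m (A.s y) (A.t x)

/-- Parallel cells: same source and same target (no condition on `0`-cells). -/
def Parallel (A : RGSet.{u} n) : ∀ m : ℕ, A.cells m → A.cells m → Prop
  | 0, _, _ => True
  | _ + 1, x, y => A.s x = A.s y ∧ A.t x = A.t y

/-- `A.idS k m _ x = i ^ (m - k) (s ^ (m - k) x)` for `k < m`. -/
def idS (A : RGSet.{u} n) (k : ℕ) : ∀ m : ℕ, m ≤ n → A.cells m → A.cells m
  | 0, _, x => x
  | m + 1, h, x => A.i h (if k = m then A.s x else idS A k m (Nat.le_of_succ_le h) (A.s x))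

/-- `A.idT k m _ x = i ^ (m - k) (t ^ (m - k) x)` for `k < m`. -/
def idT (A : RGSet.{u} n) (k : ℕ) : ∀ m : ℕ, m ≤ n → A.cells m → A.cells m
  | 0, _, x => x
  | m + 1, h, x => A.i h (if k = m then A.t x else idT A k m (Nat.le_of_succ_le h) (A.t x))

theorem Composable.map {A B : RGSet.{u} n} (f : Hom A B) {k : ℕ} :
    ∀ {m : ℕ} {y x : A.cells m}, A.Composable k m y x → B.Composable k m (f.map y) (f.map x)
  | 0, _, _, h => h
  | m + 1, y, x, h => by
    unfold Composable at h ⊢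
    split_ifs at h ⊢ with hk
    · rw [← f.map_t, ← f.map_s, h]
    · rw [← f.map_t, ← f.map_s]
      exact Composable.map f h

theorem Parallel.map {A B : RGSet.{u} n} (f : Hom A B) :
    ∀ {m : ℕ} {x y : A.cells m}, A.Parallel m x y → B.Parallel m (f.map x) (f.map y)
  | 0, _, _, _ => trivial
  | m + 1, x, y, h => by
    exact ⟨by rw [← f.map_s, ← f.map_s, h.1], by rw [← f.map_t, ← f.map_t, h.2]⟩

theorem map_idS {A B : RGSet.{u} n} (f : Hom A B) (k : ℕ) :
    ∀ (m : ℕ) (h : m ≤ n) (x : A.cells m), f.map (A.idS k m h x) = B.idS k m h (f.map x)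
  | 0, _, _ => rfl
  | m + 1, h, x => by
    unfold idS
    rw [f.map_i]
    split_ifs with hk
    · rw [f.map_s]
    · rw [map_idS f k m, f.map_s]

theorem map_idT {A B : RGSet.{u} n} (f : Hom A B) (k : ℕ) :
    ∀ (m : ℕ) (h : m ≤ n) (x : A.cells m), f.map (A.idT k m h x) = B.idT k m h (f.map x)
  | 0, _, _ => rfl
  | m + 1, h, x => by
    unfold idT
    rw [f.map_i]
    split_ifs with hk
    · rw [f.map_t]
    · rw [map_idT f k m, f.map_t]

end RGSet

/-- An `n`-dimensional magma: `comp k y x _` is the composite `y ∘ₖ x` of `m`-cells along `k`-cells.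
In this and in the following structures every composability assumption on boundaries or on
composites is a consequence of the assumptions on the cells that are composed first. -/
structure Magma (n : ℕ) extends RGSet.{u} n where
  comp : ∀ (k : ℕ) {m : ℕ} (y x : cells m), toRGSet.Composable k m y x → cells m
  s_comp_self : ∀ {m : ℕ} (y x : cells (m + 1)) (h : toRGSet.Composable m (m + 1) y x),
    s (comp m y x h) = s x
  t_comp_self : ∀ {m : ℕ} (y x : cells (m + 1)) (h : toRGSet.Composable m (m + 1) y x),
    t (comp m y x h) = t y
  s_comp : ∀ {k m : ℕ}, k < m → ∀ (y x : cells (m + 1)) (h : toRGSet.Composable k (m + 1) y x)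
    (h' : toRGSet.Composable k m (s y) (s x)), s (comp k y x h) = comp k (s y) (s x) h'
  t_comp : ∀ {k m : ℕ}, k < m → ∀ (y x : cells (m + 1)) (h : toRGSet.Composable k (m + 1) y x)
    (h' : toRGSet.Composable k m (t y) (t x)), t (comp k y x h) = comp k (t y) (t x) h'

/-- Maps of magmas. -/
@[ext]
structure Magma.Hom {n : ℕ} (A B : Magma.{u} n) extends RGSet.Hom A.toRGSet B.toRGSet where
  map_comp : ∀ (k : ℕ) {m : ℕ} (y x : A.cells m) (h : A.Composable k m y x),
    map (A.comp k y x h) = B.comp k (map y) (map x) (h.map toHom)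

/-- The identity map of a magma. -/
def Magma.Hom.id {n : ℕ} (A : Magma.{u} n) : Magma.Hom A A where
  map x := x
  map_s _ := rfl
  map_t _ := rfl
  map_i _ _ := rfl
  map_comp _ _ _ _ _ := rfl

/-- Composition of maps of magmas. -/
def Magma.Hom.comp {n : ℕ} {A B C : Magma.{u} n} (f : Magma.Hom A B) (g : Magma.Hom B C) :
    Magma.Hom A C where
  map x := g.map (f.map x)
  map_s x := by rw [f.map_s, g.map_s]
  map_t x := by rw [f.map_t, g.map_t]
  map_i h x := by rw [f.map_i, g.map_i]
  map_comp k _ y x h := by rw [f.map_comp, g.map_comp]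

/-- Strict `n`-categories. -/
structure StrictCat (n : ℕ) extends Magma.{u} n where
  assoc : ∀ (k : ℕ) {m : ℕ} (z y x : cells m) (h₁ : toRGSet.Composable k m z y)
    (h₂ : toRGSet.Composable k m y x) (h₃ : toRGSet.Composable k m (comp k z y h₁) x)
    (h₄ : toRGSet.Composable k m z (comp k y x h₂)),
    comp k (comp k z y h₁) x h₃ = comp k z (comp k y x h₂) h₄
  comp_id : ∀ (k : ℕ) {m : ℕ} (hm : m ≤ n) (x : cells m)
    (h : toRGSet.Composable k m x (toRGSet.idS k m hm x)),
    comp k x (toRGSet.idS k m hm x) h = x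
  id_comp : ∀ (k : ℕ) {m : ℕ} (hm : m ≤ n) (x : cells m)
    (h : toRGSet.Composable k m (toRGSet.idT k m hm x) x),
    comp k (toRGSet.idT k m hm x) x h = x
  interchange : ∀ {p k : ℕ}, p < k → ∀ {m : ℕ} (y' y x' x : cells m)
    (h₁ : toRGSet.Composable k m y' y) (h₂ : toRGSet.Composable k m x' x)
    (h₃ : toRGSet.Composable p m (comp k y' y h₁) (comp k x' x h₂))
    (h₄ : toRGSet.Composable p m y' x') (h₅ : toRGSet.Composable p m y x)
    (h₆ : toRGSet.Composable k m (comp p y' x' h₄) (comp p y x h₅)),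
    comp p (comp k y' y h₁) (comp k x' x h₂) h₃ = comp k (comp p y' x' h₄) (comp p y x h₅) h₆
  i_comp : ∀ (k : ℕ) {m : ℕ} (hm : m < n) (y x : cells m) (h : toRGSet.Composable k m y x)
    (h' : toRGSet.Composable k (m + 1) (i hm y) (i hm x)),
    i hm (comp k y x h) = comp k (i hm y) (i hm x) h'

/-- Contractions on a map `f` of `n`-dimensional reflexive globular sets. -/
structure Contraction {n : ℕ} {A B : RGSet.{u} n} (f : RGSet.Hom A B) where
  cell : ∀ {m : ℕ}, m < n → ∀ x y : A.cells m, A.Parallel m x y → f.map x = f.map y →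
    A.cells (m + 1)
  s_cell : ∀ {m : ℕ} (hm : m < n) (x y : A.cells m) (h : A.Parallel m x y)
    (h' : f.map x = f.map y), A.s (cell hm x y h h') = x
  t_cell : ∀ {m : ℕ} (hm : m < n) (x y : A.cells m) (h : A.Parallel m x y)
    (h' : f.map x = f.map y), A.t (cell hm x y h h') = y
  map_cell : ∀ {m : ℕ} (hm : m < n) (x y : A.cells m) (h : A.Parallel m x y)
    (h' : f.map x = f.map y), f.map (cell hm x y h h') = B.i hm (f.map x)
  cell_self : ∀ {m : ℕ} (hm : m < n) (x : A.cells m) (h : A.Parallel m x x),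
    cell hm x x h rfl = A.i hm x
  eq_of_top : ∀ x y : A.cells n, A.Parallel n x y → f.map x = f.map y → x = y

/-- The objects of the category `Q`: a magma over a strict `n`-category, with a contraction. -/
structure Q (n : ℕ) where
  A : Magma.{u} n
  B : StrictCat.{u} n
  f : Magma.Hom A B.toMagma
  con : Contraction f.toHom

namespace Q

variable {n : ℕ}

/-- Morphisms of `Q`: commutative squares that preserve the contraction cells. -/
@[ext]
structure Hom (E E' : Q.{u} n) where
  top : Magma.Hom E.A E'.A
  bot : Magma.Hom E.B.toMagma E'.B.toMagma
  comm : ∀ {m : ℕ} (x : E.A.cells m), E'.f.map (top.map x) = bot.map (E.f.map x)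
  map_con : ∀ {m : ℕ} (hm : m < n) (x y : E.A.cells m) (h : E.A.Parallel m x y)
    (h' : E.f.map x = E.f.map y),
    top.map (E.con.cell hm x y h h') = E'.con.cell hm (top.map x) (top.map y)
      (h.map top.toHom) (by rw [comm, comm, h'])

instance : Category (Q.{u} n) where
  Hom := Hom
  id E :=
    { top := Magma.Hom.id E.A
      bot := Magma.Hom.id E.B.toMagma
      comm := fun _ => rfl
      map_con := fun _ _ _ _ _ => rfl }
  comp F G :=
    { top := F.top.comp G.top
      bot := F.bot.comp G.bot
      comm := fun x => (G.comm _).trans (congrArg G.bot.map (F.comm x))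
      map_con := fun hm x y h h' =>
        (congrArg G.top.map (F.map_con hm x y h h')).trans (G.map_con hm _ _ _ _) }
  id_comp _ := rfl
  comp_id _ := rfl
  assoc _ _ _ := rfl

/-- The forgetful functor from `Q` to reflexive globular sets. -/
def forget (n : ℕ) : Q.{u} n ⥤ RGSet.{u} n where
  obj E := E.A.toRGSet
  map {_ _} (F : Hom _ _) := F.top.toHom

end Q

/-! ### The left adjoint of the forgetful functor

Its value at `X` is the set of formal terms over `X` that can be evaluated in every object of `Q`
under `X`, modulo equality of all the values. -/

section Free

variable {n : ℕ}

/-- The two layers of an object of `Q`. -/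
def Q.lay (E : Q.{u} n) : Bool → Magma.{u} n
  | true => E.A
  | false => E.B.toMagma

/-- Formal terms for the cells of the two layers of the free object on `X`. -/
inductive Tm (X : RGSet.{u} n) : Bool → ℕ → Type u
  | gen {m : ℕ} : X.cells m → Tm X true m
  | s {b : Bool} {m : ℕ} : Tm X b (m + 1) → Tm X b m
  | t {b : Bool} {m : ℕ} : Tm X b (m + 1) → Tm X b m
  | i {b : Bool} {m : ℕ} : Tm X b m → Tm X b (m + 1)
  | comp {b : Bool} {m : ℕ} (k : ℕ) : Tm X b m → Tm X b m → Tm X b m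
  | con {m : ℕ} : Tm X true m → Tm X true m → Tm X true (m + 1)
  | phi {m : ℕ} : Tm X true m → Tm X false m

variable (X : RGSet.{u} n)

/-- Objects of `Q` under `X`. -/
structure Under where
  E : Q.{u} n
  g : RGSet.Hom X E.A.toRGSet

variable {X}

/-- `Ev j x v`: the term `x` has the value `v` in `j`. -/
inductive Ev (j : Under X) : ∀ {b : Bool} {m : ℕ}, Tm X b m → (j.E.lay b).cells m → Prop
  | gen {m : ℕ} (x : X.cells m) : Ev j (b := true) (.gen x) (j.g.map x)
  | s {b : Bool} {m : ℕ} {x : Tm X b (m + 1)} {v : (j.E.lay b).cells (m + 1)} :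
      Ev j x v → Ev j (.s x) ((j.E.lay b).s v)
  | t {b : Bool} {m : ℕ} {x : Tm X b (m + 1)} {v : (j.E.lay b).cells (m + 1)} :
      Ev j x v → Ev j (.t x) ((j.E.lay b).t v)
  | i {b : Bool} {m : ℕ} (hm : m < n) {x : Tm X b m} {v : (j.E.lay b).cells m} :
      Ev j x v → Ev j (.i x) ((j.E.lay b).i hm v)
  | comp {b : Bool} {m : ℕ} (k : ℕ) {y x : Tm X b m} {w v : (j.E.lay b).cells m}
      (h : (j.E.lay b).Composable k m w v) :
      Ev j y w → Ev j x v → Ev j (.comp k y x) ((j.E.lay b).comp k w v h)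
  | con {m : ℕ} (hm : m < n) {y x : Tm X true m} {w v : j.E.A.cells m}
      (h : j.E.A.Parallel m w v) (h' : j.E.f.map w = j.E.f.map v) :
      Ev j (b := true) y w → Ev j (b := true) x v →
      Ev j (b := true) (.con y x) (j.E.con.cell hm w v h h')
  | phi {m : ℕ} {x : Tm X true m} {v : j.E.A.cells m} :
      Ev j (b := true) x v → Ev j (b := false) (.phi x) (j.E.f.map v)

theorem Ev.unique {j : Under X} {b : Bool} {m : ℕ} {x : Tm X b m} {v w : (j.E.lay b).cells m}
    (h : Ev j x v) (h' : Ev j x w) : v = w := by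
  induction h with
  | gen x => cases h'; rfl
  | s _ ih => cases h' with | s h' => rw [ih h']
  | t _ ih => cases h' with | t h' => rw [ih h']
  | i hm _ ih => cases h' with | i _ h' => rw [ih h']
  | comp k h _ _ ih₁ ih₂ =>
    cases h' with | comp _ _ h₁ h₂ => cases ih₁ h₁; cases ih₂ h₂; rfl
  | con hm _ _ _ _ ih₁ ih₂ =>
    cases h' with | con _ _ _ h₁ h₂ => cases ih₁ h₁; cases ih₂ h₂; rfl
  | phi _ ih => cases h' with | phi h' => rw [ih h']

variable (X) in
/-- The terms of dimension at most `n` that have a value in every object of `Q` under `X`. -/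
def DefTm (b : Bool) (m : ℕ) : Type u :=
  {x : Tm X b m // m ≤ n ∧ ∀ j : Under X, ∃ v, Ev j x v}

variable (X) in
/-- Terms with the same values. -/
def defSetoid (b : Bool) (m : ℕ) : Setoid (DefTm X b m) where
  r x y := ∀ j v, Ev j x.1 v ↔ Ev j y.1 v
  iseqv :=
    { refl := fun _ _ _ => Iff.rfl
      symm := fun h j v => (h j v).symm
      trans := fun h h' j v => (h j v).trans (h' j v) }

variable (X) in
/-- The cells of the two layers of the free object on `X`. -/
def Cell (b : Bool) (m : ℕ) : Type u := _root_.Quotient (defSetoid X b m)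

namespace Cell

variable {b : Bool} {m : ℕ}

/-- A term that represents `q`. -/
noncomputable def rep (q : Cell X b m) : Tm X b m := (_root_.Quotient.out q).1

theorem le (q : Cell X b m) : m ≤ n := (_root_.Quotient.out q).2.1

/-- The value of a cell. -/
noncomputable def val (q : Cell X b m) (j : Under X) : (j.E.lay b).cells m :=
  ((_root_.Quotient.out q).2.2 j).choose

theorem ev (q : Cell X b m) (j : Under X) : Ev j q.rep (q.val j) :=
  ((_root_.Quotient.out q).2.2 j).choose_spec

theorem ext {q r : Cell X b m} (h : ∀ j, q.val j = r.val j) : q = r := by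
  refine _root_.Quotient.out_equiv_out.1 fun j v => ?_
  constructor
  · intro hv
    rw [hv.unique (q.ev j), h]
    exact r.ev j
  · intro hv
    rw [hv.unique (r.ev j), ← h]
    exact q.ev j

/-- The cell of a term with given values. -/
def mk (hm : m ≤ n) (x : Tm X b m) (v : ∀ j : Under X, (j.E.lay b).cells m)
    (h : ∀ j, Ev j x (v j)) : Cell X b m :=
  _root_.Quotient.mk _ (⟨x, hm, fun j => ⟨v j, h j⟩⟩ : DefTm X b m)

theorem val_mk (hm : m ≤ n) (x : Tm X b m) (v : ∀ j : Under X, (j.E.lay b).cells m)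
    (h : ∀ j, Ev j x (v j)) (j : Under X) : (mk hm x v h).val j = v j := by
  have h₁ := _root_.Quotient.mk_out (s := defSetoid X b m)
    (⟨x, hm, fun j => ⟨v j, h j⟩⟩ : DefTm X b m)
  exact ((h₁ j _).1 ((mk hm x v h).ev j)).unique (h j)

end Cell

variable (X) in
/-- The reflexive globular sets of cells of the free object on `X`. -/
noncomputable def freeRG (b : Bool) : RGSet.{u} n where
  cells := Cell X b
  isEmpty_cells h := ⟨fun q => absurd q.le (Nat.not_le.2 h)⟩
  s q := .mk (Nat.le_of_succ_le q.le) (.s q.rep) (fun j => (j.E.lay b).s (q.val j))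
    fun j => .s (q.ev j)
  t q := .mk (Nat.le_of_succ_le q.le) (.t q.rep) (fun j => (j.E.lay b).t (q.val j))
    fun j => .t (q.ev j)
  i hm q := .mk hm (.i q.rep) (fun j => (j.E.lay b).i hm (q.val j)) fun j => .i hm (q.ev j)
  s_s q := Cell.ext fun j => by simp only [Cell.val_mk, RGSet.s_s]
  t_s q := Cell.ext fun j => by simp only [Cell.val_mk, RGSet.t_s]
  s_i hm q := Cell.ext fun j => by simp only [Cell.val_mk, RGSet.s_i]
  t_i hm q := Cell.ext fun j => by simp only [Cell.val_mk, RGSet.t_i]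

theorem val_s {b : Bool} {m : ℕ} (q : (freeRG X b).cells (m + 1)) (j : Under X) :
    Cell.val ((freeRG X b).s q) j = (j.E.lay b).s (Cell.val q j) :=
  Cell.val_mk (Nat.le_of_succ_le (Cell.le q)) _ (fun j => (j.E.lay b).s (Cell.val q j)) (fun j => .s (Cell.ev q j)) j

theorem val_t {b : Bool} {m : ℕ} (q : (freeRG X b).cells (m + 1)) (j : Under X) :
    Cell.val ((freeRG X b).t q) j = (j.E.lay b).t (Cell.val q j) :=
  Cell.val_mk (Nat.le_of_succ_le (Cell.le q)) _ (fun j => (j.E.lay b).t (Cell.val q j)) (fun j => .t (Cell.ev q j)) j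

theorem val_i {b : Bool} {m : ℕ} (hm : m < n) (q : (freeRG X b).cells m) (j : Under X) :
    Cell.val ((freeRG X b).i hm q) j = (j.E.lay b).i hm (Cell.val q j) :=
  Cell.val_mk hm _ (fun j => (j.E.lay b).i hm (Cell.val q j)) (fun j => .i hm (Cell.ev q j)) j

/-- Evaluation as a map of reflexive globular sets. -/
noncomputable def valRG (b : Bool) (j : Under X) : RGSet.Hom (freeRG X b) (j.E.lay b).toRGSet where
  map q := Cell.val q j
  map_s q := val_s q j
  map_t q := val_t q j
  map_i hm q := val_i hm q j

theorem freeRG_composable {b : Bool} {k : ℕ} : ∀ {m : ℕ} {y x : (freeRG X b).cells m}, k < m →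
    (∀ j : Under X, (j.E.lay b).Composable k m ((valRG b j).map y) ((valRG b j).map x)) →
    (freeRG X b).Composable k m y x
  | 0, _, _, hk, _ => absurd hk (Nat.not_lt_zero k)
  | m + 1, y, x, hk, h => by
    unfold RGSet.Composable at h ⊢
    split_ifs at h ⊢ with hkm
    · refine Cell.ext fun j => ?_
      have := h j
      rwa [← (valRG b j).map_s, ← (valRG b j).map_t] at this
    · refine freeRG_composable (by omega) fun j => ?_
      rw [(valRG b j).map_s, (valRG b j).map_t]
      exact h j

theorem freeRG_parallel {b : Bool} : ∀ {m : ℕ} {y x : (freeRG X b).cells m},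
    (∀ j : Under X, (j.E.lay b).Parallel m ((valRG b j).map y) ((valRG b j).map x)) →
    (freeRG X b).Parallel m y x
  | 0, _, _, _ => trivial
  | m + 1, y, x, h => by
    refine ⟨Cell.ext fun j => ?_, Cell.ext fun j => ?_⟩
    · have := (h j).1
      rwa [← (valRG b j).map_s, ← (valRG b j).map_s] at this
    · have := (h j).2
      rwa [← (valRG b j).map_t, ← (valRG b j).map_t] at this

theorem lt_of_composable {A : RGSet.{u} n} {k : ℕ} : ∀ {m : ℕ} {y x : A.cells m},
    A.Composable k m y x → k < m
  | 0, _, _, h => h.elim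
  | m + 1, y, x, h => by
    unfold RGSet.Composable at h
    split_ifs at h with hk
    · omega
    · exact Nat.lt_succ_of_lt (lt_of_composable h)

theorem Magma.comp_congr (A : Magma.{u} n) (k : ℕ) {m : ℕ} {y x y' x' : A.cells m}
    (hy : y = y') (hx : x = x') (h : A.Composable k m y x) (h' : A.Composable k m y' x') :
    A.comp k y x h = A.comp k y' x' h' := by
  subst hy hx
  rfl

theorem composable_congr {A : RGSet.{u} n} {k : ℕ} {m : ℕ} {y x y' x' : A.cells m}
    (hy : y = y') (hx : x = x') (h : A.Composable k m y x) : A.Composable k m y' x' := by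
  subst hy hx
  exact h

/-- Composition in the free object. -/
noncomputable def freeComp {b : Bool} (k : ℕ) {m : ℕ} (y x : (freeRG X b).cells m)
    (h : (freeRG X b).Composable k m y x) : (freeRG X b).cells m :=
  Cell.mk (Cell.le x) (.comp k (Cell.rep y) (Cell.rep x))
    (fun j => (j.E.lay b).comp k (Cell.val y j) (Cell.val x j) (h.map (valRG b j)))
    fun j => .comp k _ (Cell.ev y j) (Cell.ev x j)

theorem val_comp {b : Bool} (k : ℕ) {m : ℕ} (y x : (freeRG X b).cells m)
    (h : (freeRG X b).Composable k m y x) (j : Under X) :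
    Cell.val (freeComp k y x h) j =
      (j.E.lay b).comp k (Cell.val y j) (Cell.val x j) (h.map (valRG b j)) :=
  Cell.val_mk _ _
    (fun j => (j.E.lay b).comp k (Cell.val y j) (Cell.val x j) (h.map (valRG b j))) _ j

variable (X) in
/-- The magmas of cells of the free object on `X`. -/
noncomputable def freeMagma (b : Bool) : Magma.{u} n where
  toRGSet := freeRG X b
  comp := freeComp
  s_comp_self y x h := Cell.ext fun j =>
    (val_s _ j).trans ((congrArg (j.E.lay b).s (val_comp _ y x h j)).trans
      (((j.E.lay b).s_comp_self _ _ _).trans (val_s x j).symm))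
  t_comp_self y x h := Cell.ext fun j =>
    (val_t _ j).trans ((congrArg (j.E.lay b).t (val_comp _ y x h j)).trans
      (((j.E.lay b).t_comp_self _ _ _).trans (val_t y j).symm))
  s_comp hk y x h h' := Cell.ext fun j =>
    (val_s _ j).trans <| (congrArg (j.E.lay b).s (val_comp _ y x h j)).trans <|
      ((j.E.lay b).s_comp hk _ _ _
        (composable_congr (val_s y j) (val_s x j) (h'.map (valRG b j)))).trans <|
      ((j.E.lay b).comp_congr _ (val_s y j).symm (val_s x j).symm _ _).trans
      (val_comp _ _ _ h' j).symm
  t_comp hk y x h h' := Cell.ext fun j =>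
    (val_t _ j).trans <| (congrArg (j.E.lay b).t (val_comp _ y x h j)).trans <|
      ((j.E.lay b).t_comp hk _ _ _
        (composable_congr (val_t y j) (val_t x j) (h'.map (valRG b j)))).trans <|
      ((j.E.lay b).comp_congr _ (val_t y j).symm (val_t x j).symm _ _).trans
      (val_comp _ _ _ h' j).symm

variable (X) in
/-- The bottom layer of the free object is a strict `n`-category. -/
noncomputable def freeStrict : StrictCat.{u} n where
  toMagma := freeMagma X false
  assoc k _ z y x h₁ h₂ h₃ h₄ := Cell.ext fun j =>
    (val_comp k _ x h₃ j).trans <|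
      ((j.E.lay false).comp_congr k (val_comp k z y h₁ j) rfl _
        (composable_congr (val_comp k z y h₁ j) rfl (h₃.map (valRG false j)))).trans <|
      (j.E.B.assoc k _ _ _ _ (h₂.map (valRG false j)) _
        (composable_congr rfl (val_comp k y x h₂ j) (h₄.map (valRG false j)))).trans <|
      ((j.E.lay false).comp_congr k rfl (val_comp k y x h₂ j).symm _ _).trans
      (val_comp k z _ h₄ j).symm
  comp_id k m hm x h := Cell.ext fun j =>
    (val_comp k x _ h j).trans <|
      ((j.E.lay false).comp_congr k rfl (RGSet.map_idS (valRG false j) k m hm x) _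
        (composable_congr rfl (RGSet.map_idS (valRG false j) k m hm x)
          (h.map (valRG false j)))).trans
      (j.E.B.comp_id k hm _ _)
  id_comp k m hm x h := Cell.ext fun j =>
    (val_comp k _ x h j).trans <|
      ((j.E.lay false).comp_congr k (RGSet.map_idT (valRG false j) k m hm x) rfl _
        (composable_congr (RGSet.map_idT (valRG false j) k m hm x) rfl
          (h.map (valRG false j)))).trans
      (j.E.B.id_comp k hm _ _)
  interchange {p k} hp _ y' y x' x h₁ h₂ h₃ h₄ h₅ h₆ := Cell.ext fun j =>
    (val_comp p _ _ h₃ j).trans <|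
      ((j.E.lay false).comp_congr p (val_comp k y' y h₁ j) (val_comp k x' x h₂ j) _
        (composable_congr (val_comp k y' y h₁ j) (val_comp k x' x h₂ j)
          (h₃.map (valRG false j)))).trans <|
      (j.E.B.interchange hp _ _ _ _ _ _ _ (h₄.map (valRG false j)) (h₅.map (valRG false j))
        (composable_congr (val_comp p y' x' h₄ j) (val_comp p y x h₅ j)
          (h₆.map (valRG false j)))).trans <|
      ((j.E.lay false).comp_congr k (val_comp p y' x' h₄ j).symm (val_comp p y x h₅ j).symm
        _ _).trans
      (val_comp k _ _ h₆ j).symm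
  i_comp k _ hm y x h h' := Cell.ext fun j =>
    (val_i hm _ j).trans <| (congrArg ((j.E.lay false).i hm) (val_comp k y x h j)).trans <|
      (j.E.B.i_comp k hm _ _ _
        (composable_congr (val_i hm y j) (val_i hm x j) (h'.map (valRG false j)))).trans <|
      ((j.E.lay false).comp_congr k (val_i hm y j).symm (val_i hm x j).symm _ _).trans
      (val_comp k _ _ h' j).symm

/-- The projection of the free object, on cells. -/
noncomputable def phi {m : ℕ} (q : Cell X true m) : Cell X false m :=
  Cell.mk (Cell.le q) (.phi (Cell.rep q)) (fun j => j.E.f.map (Cell.val q j))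
    fun j => .phi (Cell.ev q j)

theorem val_phi {m : ℕ} (q : Cell X true m) (j : Under X) :
    Cell.val (phi q) j = j.E.f.map (Cell.val q j) :=
  Cell.val_mk (b := false) (Cell.le q) _ (fun j => j.E.f.map (Cell.val q j)) (fun j => .phi (Cell.ev q j)) j

variable (X) in
/-- The projection of the free object, as a map of reflexive globular sets. -/
noncomputable def freePhiRG : RGSet.Hom (freeRG X true) (freeRG X false) where
  map q := phi q
  map_s q := Cell.ext fun j =>
    (val_phi _ j).trans <| (congrArg j.E.f.map (val_s q j)).trans <| (j.E.f.map_s _).trans <|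
      (congrArg j.E.B.s (val_phi q j).symm).trans (val_s (b := false) (phi q) j).symm
  map_t q := Cell.ext fun j =>
    (val_phi _ j).trans <| (congrArg j.E.f.map (val_t q j)).trans <| (j.E.f.map_t _).trans <|
      (congrArg j.E.B.t (val_phi q j).symm).trans (val_t (b := false) (phi q) j).symm
  map_i hm q := Cell.ext fun j =>
    (val_phi _ j).trans <| (congrArg j.E.f.map (val_i hm q j)).trans <|
      (j.E.f.map_i hm _).trans <|
      (congrArg (j.E.B.i hm) (val_phi q j).symm).trans (val_i (b := false) hm (phi q) j).symm

variable (X) in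
/-- The projection of the free object. -/
noncomputable def freePhi : Magma.Hom (freeMagma X true) (freeStrict X).toMagma where
  toHom := freePhiRG X
  map_comp k _ y x h := Cell.ext fun j =>
    (val_phi _ j).trans <| (congrArg j.E.f.map (val_comp k y x h j)).trans <|
      (j.E.f.map_comp k _ _ _).trans <|
      (j.E.B.comp_congr k (val_phi y j).symm (val_phi x j).symm _ _).trans
      (val_comp (b := false) k (phi y) (phi x) (h.map (freePhiRG X)) j).symm

theorem phi_eq {m : ℕ} {x y : Cell X true m} (h : phi x = phi y) (j : Under X) :
    j.E.f.map (Cell.val x j) = j.E.f.map (Cell.val y j) := by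
  rw [← val_phi, ← val_phi, h]

/-- The contraction cells of the free object. -/
noncomputable def freeCon {m : ℕ} (hm : m < n) (x y : (freeRG X true).cells m)
    (h : (freeRG X true).Parallel m x y) (h' : phi x = phi y) : (freeRG X true).cells (m + 1) :=
  Cell.mk hm (.con (Cell.rep x) (Cell.rep y))
    (fun j => j.E.con.cell hm (Cell.val x j) (Cell.val y j) (h.map (valRG true j)) (phi_eq h' j))
    fun j => .con hm _ _ (Cell.ev x j) (Cell.ev y j)

theorem val_con {m : ℕ} (hm : m < n) (x y : (freeRG X true).cells m)
    (h : (freeRG X true).Parallel m x y) (h' : phi x = phi y) (j : Under X) :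
    Cell.val (freeCon hm x y h h') j =
      j.E.con.cell hm (Cell.val x j) (Cell.val y j) (h.map (valRG true j)) (phi_eq h' j) :=
  Cell.val_mk (b := true) _ _ (fun j => j.E.con.cell hm (Cell.val x j) (Cell.val y j)
    (h.map (valRG true j)) (phi_eq h' j)) _ j

variable (X) in
/-- The free object of `Q` on `X`. -/
noncomputable def free : Q.{u} n where
  A := freeMagma X true
  B := freeStrict X
  f := freePhi X
  con :=
    { cell := freeCon
      s_cell := fun hm x y h h' => Cell.ext fun j =>
        (val_s _ j).trans <| (congrArg j.E.A.s (val_con hm x y h h' j)).trans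
          (j.E.con.s_cell hm _ _ _ _)
      t_cell := fun hm x y h h' => Cell.ext fun j =>
        (val_t _ j).trans <| (congrArg j.E.A.t (val_con hm x y h h' j)).trans
          (j.E.con.t_cell hm _ _ _ _)
      map_cell := fun hm x y h h' => Cell.ext fun j =>
        (val_phi _ j).trans <| (congrArg j.E.f.map (val_con hm x y h h' j)).trans <|
          (j.E.con.map_cell hm _ _ _ _).trans <|
          (congrArg (j.E.B.i hm) (val_phi x j).symm).trans
          (val_i (b := false) hm (phi x) j).symm
      cell_self := fun hm x h => Cell.ext fun j =>
        (val_con hm x x h rfl j).trans <| (j.E.con.cell_self hm _ _).trans (val_i hm x j).symm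
      eq_of_top := fun _ _ h h' => Cell.ext fun j =>
        j.E.con.eq_of_top _ _ (h.map (valRG true j)) (phi_eq h' j) }

/-- Generators of the free object. -/
def genCell {m : ℕ} (x : X.cells m) : Cell X true m :=
  Cell.mk (not_lt.1 fun h => (X.isEmpty_cells h).false x) (.gen x) (fun j => j.g.map x)
    fun _ => .gen x

theorem val_gen {m : ℕ} (x : X.cells m) (j : Under X) : (genCell x).val j = j.g.map x :=
  Cell.val_mk (b := true) _ _ (fun j => j.g.map x) _ j

variable (X) in
/-- The unit of the free object. -/
def freeUnit : RGSet.Hom X (free X).A.toRGSet where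
  map x := genCell x
  map_s x := Cell.ext fun j =>
    (val_gen _ j).trans <| (j.g.map_s x).trans <|
      (congrArg j.E.A.s (val_gen x j).symm).trans (val_s (b := true) (genCell x) j).symm
  map_t x := Cell.ext fun j =>
    (val_gen _ j).trans <| (j.g.map_t x).trans <|
      (congrArg j.E.A.t (val_gen x j).symm).trans (val_t (b := true) (genCell x) j).symm
  map_i hm x := Cell.ext fun j =>
    (val_gen _ j).trans <| (j.g.map_i hm x).trans <|
      (congrArg (j.E.A.i hm) (val_gen x j).symm).trans (val_i (b := true) hm (genCell x) j).symm

/-- The morphism out of the free object that a map of reflexive globular sets induces. -/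
noncomputable def freeDesc (j : Under X) : Q.Hom (free X) j.E where
  top := { toHom := valRG true j, map_comp := fun k _ y x h => val_comp k y x h j }
  bot := { toHom := valRG false j, map_comp := fun k _ y x h => val_comp k y x h j }
  comm x := (val_phi x j).symm
  map_con hm x y h h' := val_con hm x y h h' j

/-- The two components of a morphism out of the free object. -/
def layMap {E : Q.{u} n} (F : Q.Hom (free X) E) :
    ∀ b : Bool, Magma.Hom (freeMagma X b) (E.lay b)
  | true => F.top
  | false => F.bot

theorem layMap_eq (j : Under X) (F : Q.Hom (free X) j.E)
    (hF : ∀ {m : ℕ} (x : X.cells m), F.top.map (genCell x) = j.g.map x)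
    {b : Bool} {m : ℕ} (x : Tm X b m) : ∀ q : Cell X b m,
    (∀ j, Ev j x (q.val j)) → (layMap F b).map q = q.val j := by
  have key : ∀ {b : Bool} {m : ℕ} (x : Tm X b m) (v : ∀ j : Under X, (j.E.lay b).cells m)
      (_ : ∀ j, Ev j x (v j)), (∀ q : Cell X b m,
      (∀ j, Ev j x (q.val j)) → (layMap F b).map q = q.val j) →
      ∃ q : Cell X b m, (∀ j, q.val j = v j) ∧ (layMap F b).map q = q.val j := by
    intro b m x v hv ih
    refine ⟨Cell.mk (not_lt.1 fun h => ((j.E.lay b).isEmpty_cells h).false (v j)) x v hv,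
      fun j => Cell.val_mk _ _ _ _ j, ih _ fun j => ?_⟩
    rw [Cell.val_mk]
    exact hv j
  induction x with
  | gen x =>
    intro q hq
    have : q = genCell x := Cell.ext fun j => (hq j).unique <| by
      rw [val_gen]; exact .gen x
    subst this
    rw [val_gen]
    exact hF x
  | @s b m x ih =>
    intro q hq
    have : ∀ j, ∃ v, Ev j x v ∧ (j.E.lay b).s v = q.val j := fun j => by
      have := hq j
      generalize q.val j = w at this
      cases this with | s h => exact ⟨_, h, rfl⟩
    choose v hv hv' using this
    obtain ⟨q', h₁, h₂⟩ := key x v hv ih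
    have : q = (freeRG X b).s q' := Cell.ext fun j =>
      ((hv' j).symm.trans (congrArg (j.E.lay b).s (h₁ j).symm)).trans (val_s q' j).symm
    subst this
    exact ((layMap F b).map_s q').trans ((congrArg _ h₂).trans (val_s q' j).symm)
  | @t b m x ih =>
    intro q hq
    have : ∀ j, ∃ v, Ev j x v ∧ (j.E.lay b).t v = q.val j := fun j => by
      have := hq j
      generalize q.val j = w at this
      cases this with | t h => exact ⟨_, h, rfl⟩
    choose v hv hv' using this
    obtain ⟨q', h₁, h₂⟩ := key x v hv ih
    have : q = (freeRG X b).t q' := Cell.ext fun j =>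
      ((hv' j).symm.trans (congrArg (j.E.lay b).t (h₁ j).symm)).trans (val_t q' j).symm
    subst this
    exact ((layMap F b).map_t q').trans ((congrArg _ h₂).trans (val_t q' j).symm)
  | @i b m x ih =>
    intro q hq
    have hm : m < n := q.le
    have : ∀ j, ∃ v, Ev j x v ∧ (j.E.lay b).i hm v = q.val j := fun j => by
      have := hq j
      generalize q.val j = w at this
      cases this with | i _ h => exact ⟨_, h, rfl⟩
    choose v hv hv' using this
    obtain ⟨q', h₁, h₂⟩ := key x v hv ih
    have : q = (freeRG X b).i hm q' := Cell.ext fun j =>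
      ((hv' j).symm.trans (congrArg ((j.E.lay b).i hm) (h₁ j).symm)).trans (val_i hm q' j).symm
    subst this
    exact ((layMap F b).map_i hm q').trans ((congrArg _ h₂).trans (val_i hm q' j).symm)
  | @comp b m k y x ih₁ ih₂ =>
    intro q hq
    have : ∀ j, ∃ w v, Ev j y w ∧ Ev j x v ∧
        ∃ h : (j.E.lay b).Composable k m w v, (j.E.lay b).comp k w v h = q.val j := fun j => by
      have := hq j
      generalize q.val j = w at this
      cases this with | comp _ h h₁ h₂ => exact ⟨_, _, h₁, h₂, h, rfl⟩
    choose w v hw hv hc he using this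
    obtain ⟨q₁, h₁, h₁'⟩ := key y w hw ih₁
    obtain ⟨q₂, h₂, h₂'⟩ := key x v hv ih₂
    have h : (freeRG X b).Composable k m q₁ q₂ :=
      freeRG_composable (lt_of_composable (hc j)) fun j =>
        composable_congr (h₁ j).symm (h₂ j).symm (hc j)
    have : q = freeComp k q₁ q₂ h := Cell.ext fun j =>
      ((he j).symm.trans ((j.E.lay b).comp_congr k (h₁ j).symm (h₂ j).symm _ _)).trans
        (val_comp k q₁ q₂ h j).symm
    subst this
    exact ((layMap F b).map_comp k q₁ q₂ h).trans
      (((j.E.lay b).comp_congr k h₁' h₂' _ _).trans (val_comp k q₁ q₂ h j).symm)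
  | @con m y x ih₁ ih₂ =>
    intro q hq
    have hm : m < n := q.le
    have : ∀ j, ∃ w v : j.E.A.cells m, Ev j (b := true) y w ∧ Ev j (b := true) x v ∧
        ∃ (h : j.E.A.Parallel m w v) (h' : j.E.f.map w = j.E.f.map v),
          j.E.con.cell hm w v h h' = q.val j := fun j => by
      have := hq j
      generalize q.val j = w at this
      cases this with | con _ h h' h₁ h₂ => exact ⟨_, _, h₁, h₂, h, h', rfl⟩
    choose w v hw hv hp hf he using this
    obtain ⟨q₁, h₁, h₁'⟩ := key (b := true) y w hw ih₁
    obtain ⟨q₂, h₂, h₂'⟩ := key (b := true) x v hv ih₂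
    have congr : ∀ (E : Q.{u} n) (w v w' v' : E.A.cells m), w = w' → v = v' →
        ∀ (h₁ : E.A.Parallel m w v) (h₂ : E.f.map w = E.f.map v) (h₁' : E.A.Parallel m w' v')
          (h₂' : E.f.map w' = E.f.map v'), E.con.cell hm w v h₁ h₂ = E.con.cell hm w' v' h₁' h₂' := by
      rintro E w v _ _ rfl rfl _ _ _ _
      rfl
    have h : (freeRG X true).Parallel m q₁ q₂ := freeRG_parallel fun j => by
      change j.E.A.Parallel m (q₁.val j) (q₂.val j)
      rw [h₁, h₂]
      exact hp j
    have h' : phi q₁ = phi q₂ := Cell.ext fun j => by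
      rw [val_phi, val_phi, h₁, h₂]
      exact hf j
    have : q = freeCon hm q₁ q₂ h h' := Cell.ext fun j =>
      ((he j).symm.trans (congr j.E _ _ _ _ (h₁ j).symm (h₂ j).symm _ _ _ _)).trans
        (val_con hm q₁ q₂ h h' j).symm
    subst this
    exact (F.map_con hm q₁ q₂ h h').trans
      ((congr j.E _ _ _ _ h₁' h₂' _ _ _ _).trans (val_con hm q₁ q₂ h h' j).symm)
  | @phi m x ih =>
    intro q hq
    have : ∀ j, ∃ v : j.E.A.cells m, Ev j (b := true) x v ∧ j.E.f.map v = q.val j := fun j => by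
      have := hq j
      generalize q.val j = w at this
      cases this with | phi h => exact ⟨_, h, rfl⟩
    choose v hv hv' using this
    obtain ⟨q', h₁, h₂⟩ := key (b := true) x v hv ih
    have : q = phi q' := Cell.ext fun j => by rw [val_phi, h₁, hv']
    subst this
    exact (F.comm q').symm.trans ((congrArg _ h₂).trans (val_phi q' j).symm)

theorem hom_eq_freeDesc (j : Under X) (F : Q.Hom (free X) j.E)
    (hF : ∀ {m : ℕ} (x : X.cells m), F.top.map (genCell x) = j.g.map x) : F = freeDesc j := by
  refine Q.Hom.ext (Magma.Hom.ext ?_) (Magma.Hom.ext ?_)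
  · funext m q
    exact layMap_eq j F hF (b := true) (Cell.rep q) q (Cell.ev q)
  · funext m q
    exact layMap_eq j F hF (b := false) (Cell.rep q) q (Cell.ev q)

end Free

/-- The forgetful functor from `Q` to reflexive globular sets has a left adjoint. -/
instance (n : ℕ) : (Q.forget.{u} n).IsRightAdjoint :=
  (Adjunction.adjunctionOfEquivLeft (G := Q.forget.{u} n) (F_obj := fun X => free X)
    (fun X E =>
      { toFun := fun F => (show X ⟶ (free X).A.toRGSet from freeUnit X) ≫ (Q.forget n).map F
        invFun := fun g => freeDesc ⟨E, g⟩
        left_inv := fun F => (hom_eq_freeDesc ⟨E, _⟩ F fun _ => rfl).symm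
        right_inv := fun g => RGSet.Hom.ext (by
          funext m x
          exact val_gen x ⟨E, g⟩) })
    (fun X E E' g F => rfl)).isRightAdjoint

/-- The monad `Pₙ` on `n`-dimensional reflexive globular sets. A (reflexive) Penon `n`-category is
an algebra for it. -/
noncomputable def monad (n : ℕ) : Monad (RGSet.{u} n) :=
  (Adjunction.ofIsRightAdjoint (Q.forget.{u} n)).toMonad

/-- The composition of a Penon `n`-category `X`: `y ∘ₖ x` is the image under the structure map
`Pₙ X ⟶ X` of the composite of the generators `y` and `x` in the magma `Pₙ X`. -/
noncomputable def algComp {n : ℕ} (X : (monad.{u} n).Algebra) (k : ℕ) {m : ℕ} (y x : X.A.cells m)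
    (h : X.A.Composable k m y x) : X.A.cells m :=
  X.a.map (((Q.forget n).leftAdjoint.obj X.A).A.comp k (((monad n).η.app X.A).map y)
    (((monad n).η.app X.A).map x) (h.map ((monad n).η.app X.A)))

end Penon

/-- The relations of the braid group on `n` strands, between the generators `σ₀, …, σₙ₋₂`. -/
inductive BraidRel (n : ℕ) : FreeGroup {i : ℕ // i + 1 < n} → Prop
  | comm (i j : {i : ℕ // i + 1 < n}) (h : i.1 + 2 ≤ j.1) :
      BraidRel n (.of i * .of j * (.of j * .of i)⁻¹)
  | braid (i j : {i : ℕ // i + 1 < n}) (h : i.1 + 1 = j.1) :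
      BraidRel n (.of i * .of j * .of i * (.of j * .of i * .of j)⁻¹)

/-- The braid group on `n` strands. -/
abbrev BraidGroup (n : ℕ) : Type := PresentedGroup {r | BraidRel n r}

namespace BraidGroup

/-- The generator `σᵢ` (and `1` if there is none). -/
def σ {n : ℕ} (i : ℕ) : BraidGroup n := if h : i + 1 < n then .of ⟨i, h⟩ else 1

variable {n : ℕ}

theorem σ_comm {i j : ℕ} (h : i + 2 ≤ j) : (σ i * σ j : BraidGroup n) = σ j * σ i := by
  unfold σ
  split_ifs with h₁ h₂
  · rw [← mul_inv_eq_one]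
    exact PresentedGroup.one_of_mem (BraidRel.comm ⟨i, h₁⟩ ⟨j, h₂⟩ h)
  all_goals simp

theorem σ_braid {i : ℕ} (h : i + 2 < n) :
    (σ i * σ (i + 1) * σ i : BraidGroup n) = σ (i + 1) * σ i * σ (i + 1) := by
  have h₁ : i + 1 < n := by omega
  rw [σ, σ, dif_pos h, dif_pos h₁, ← mul_inv_eq_one]
  exact PresentedGroup.one_of_mem (BraidRel.braid ⟨i, h₁⟩ ⟨i + 1, h⟩ rfl)

/-- For `d + n ≤ N`, the inclusion that puts a braid on the strands `d, …, d + n - 1`. -/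
def emb (d : ℕ) {n : ℕ} (N : ℕ) (h : d + n ≤ N) : BraidGroup n →* BraidGroup N :=
  PresentedGroup.toGroup (f := fun i => σ (d + i.1)) (by
    rintro r (⟨i, j, hij⟩ | ⟨i, j, hij⟩)
    · simp only [map_mul, map_inv, FreeGroup.lift_apply_of, mul_inv_eq_one]
      exact σ_comm (by omega)
    · simp only [map_mul, map_inv, FreeGroup.lift_apply_of, mul_inv_eq_one, ← hij]
      have := j.2
      exact σ_braid (by omega))

theorem emb_σ {d N : ℕ} (h : d + n ≤ N) {i : ℕ} (hi : i + 1 < n) :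
    emb d N h (σ i : BraidGroup n) = σ (d + i) := by
  rw [σ, dif_pos hi]
  exact PresentedGroup.toGroup.of _

theorem hom_ext {G : Type*} [Group G] {f g : BraidGroup n →* G}
    (h : ∀ i, i + 1 < n → f (σ i) = g (σ i)) : f = g :=
  PresentedGroup.ext fun i => by
    have := h i.1 i.2
    rwa [σ, dif_pos i.2] at this

theorem emb_self (h : 0 + n ≤ n) (b : BraidGroup n) : emb 0 n h b = b := by
  have : emb 0 n h = MonoidHom.id _ := hom_ext fun i hi => by simp [emb_σ h hi]
  rw [this]
  rfl

theorem emb_emb {d d' e N N' : ℕ} (h : d + n ≤ N) (h' : d' + N ≤ N') (h'' : e + n ≤ N')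
    (he : d' + d = e) (b : BraidGroup n) : emb d' N' h' (emb d N h b) = emb e N' h'' b := by
  have : (emb d' N' h').comp (emb d N h) = emb e N' h'' := hom_ext fun i hi => by
    rw [MonoidHom.comp_apply, emb_σ h hi, emb_σ h'' hi, emb_σ h' (by omega), ← he, add_assoc]
  rw [← this]
  rfl

theorem eq_of_conj {G : Type*} [Group G] {f g : BraidGroup n →* G} (c : G)
    (h : ∀ i, i + 1 < n → f (σ i) * c = c * g (σ i)) (b : BraidGroup n) :
    f b * c = c * g b := by
  have : f = (MulAut.conj c).toMonoidHom.comp g := hom_ext fun i hi => by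
    have := h i hi
    simp [← this]
  rw [this]
  simp

theorem emb_comm {m d e N : ℕ} (h : d + m ≤ N) (h' : e + n ≤ N) (hde : d + m ≤ e)
    (a : BraidGroup m) (b : BraidGroup n) :
    emb d N h a * emb e N h' b = emb e N h' b * emb d N h a := by
  refine eq_of_conj (g := emb d N h) _ (fun i hi => ?_) a
  refine (eq_of_conj (f := emb e N h') (g := emb e N h') _ (fun j hj => ?_) b).symm
  rw [emb_σ h hi, emb_σ h' hj]
  exact (σ_comm (by omega)).symm

/-- The braid `σₒ₊ₘ₋₁ ⋯ σₒ` that moves the strand `o + m` past the `m` strands before it. -/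
def cross (o : ℕ) : ℕ → BraidGroup n
  | 0 => 1
  | m + 1 => σ (o + m) * cross o m

/-- The braid that moves the `k` strands from `o + m` on, in order, past the `m` strands from `o`
on. -/
def block (o m : ℕ) : ℕ → BraidGroup n
  | 0 => 1
  | k + 1 => block o m k * cross (o + k) m

theorem cross_comm_right {o j : ℕ} : ∀ {m : ℕ}, o + m + 1 ≤ j →
    (σ j * cross o m : BraidGroup n) = cross o m * σ j
  | 0, _ => by simp [cross]
  | m + 1, h => by
    rw [cross, ← mul_assoc, ← σ_comm (by omega), mul_assoc, cross_comm_right (by omega), mul_assoc]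

theorem cross_comm_left {o j : ℕ} (h : j + 2 ≤ o) : ∀ {m : ℕ},
    (σ j * cross o m : BraidGroup n) = cross o m * σ j
  | 0 => by simp [cross]
  | m + 1 => by
    rw [cross, ← mul_assoc, σ_comm (by omega), mul_assoc, cross_comm_left h, mul_assoc]

theorem σ_mul_cross {o i : ℕ} (ho : o ≤ i) : ∀ {m : ℕ}, i + 1 < o + m → o + m < n →
    (σ i * cross o m : BraidGroup n) = cross o m * σ (i + 1)
  | 0, h, _ => by omega
  | m + 1, h, hn => by
    rcases Nat.lt_or_ge (i + 1) (o + m) with h' | h'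
    · rw [cross, ← mul_assoc, σ_comm (by omega), mul_assoc, σ_mul_cross ho h' (by omega), mul_assoc]
    · obtain ⟨k, rfl⟩ : ∃ k, m = k + 1 := ⟨m - 1, by omega⟩
      obtain rfl : i = o + k := by omega
      rw [cross, cross, ← add_assoc, ← mul_assoc, ← mul_assoc, σ_braid (by omega), mul_assoc,
        cross_comm_right (by omega)]
      simp only [mul_assoc]

theorem σ_mul_cross_cross {o : ℕ} : ∀ {m : ℕ}, o + m + 1 < n →
    (σ (o + m) * (cross o m * cross (o + 1) m) : BraidGroup n) =
      cross o m * cross (o + 1) m * σ o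
  | 0, _ => by simp [cross]
  | m + 1, h => by
    have e : (cross o (m + 1) * cross (o + 1) (m + 1) : BraidGroup n) =
        σ (o + m) * σ (o + m + 1) * (cross o m * cross (o + 1) m) := by
      rw [cross, cross, show o + 1 + m = o + m + 1 by omega, mul_assoc,
        ← mul_assoc (cross o m), ← cross_comm_right (by omega)]
      simp only [mul_assoc]
    rw [e, mul_assoc _ _ (σ o), ← σ_mul_cross_cross (by omega), ← mul_assoc, ← mul_assoc,
      ← mul_assoc, ← mul_assoc, ← add_assoc, ← σ_braid (by omega)]
    simp only [mul_assoc]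

theorem block_comm {o m j : ℕ} : ∀ {k : ℕ}, o + m + k ≤ j →
    (σ j * block o m k : BraidGroup n) = block o m k * σ j
  | 0, _ => by simp [block]
  | k + 1, h => by
    rw [block, ← mul_assoc, block_comm (by omega), mul_assoc, cross_comm_right (by omega),
      mul_assoc]

theorem σ_mul_block_left {o m i : ℕ} (ho : o ≤ i) (h : i + 1 < o + m) : ∀ {k : ℕ},
    o + m + k ≤ n → (σ i * block o m k : BraidGroup n) = block o m k * σ (i + k)
  | 0, _ => by simp [block]
  | k + 1, hn => by
    rw [block, ← mul_assoc, σ_mul_block_left ho h (by omega), mul_assoc,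
      σ_mul_cross (by omega) (by omega) (by omega), mul_assoc, add_assoc]

theorem σ_mul_block_right {o m j : ℕ} : ∀ {k : ℕ}, j + 1 < k → o + m + k ≤ n →
    (σ (o + m + j) * block o m k : BraidGroup n) = block o m k * σ (o + j)
  | 0, h, _ => by omega
  | k + 1, h, hn => by
    rcases Nat.lt_or_ge (j + 1) k with h' | h'
    · rw [block, ← mul_assoc, σ_mul_block_right h' (by omega), mul_assoc,
        cross_comm_left (by omega), mul_assoc]
    · obtain rfl : k = j + 1 := by omega
      rw [block, block, mul_assoc, ← mul_assoc, block_comm le_rfl, mul_assoc,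
        show o + m + j = o + j + m by omega, ← add_assoc, σ_mul_cross_cross (by omega)]
      simp only [mul_assoc]

theorem block_add {o m k : ℕ} : ∀ l : ℕ,
    (block o m (k + l) : BraidGroup n) = block o m k * block (o + k) m l
  | 0 => by simp [block]
  | l + 1 => by rw [← add_assoc, block, block_add l, block, mul_assoc, add_assoc]

theorem cross_add {o m : ℕ} : ∀ k : ℕ,
    (cross o (m + k) : BraidGroup n) = cross (o + m) k * cross o m
  | 0 => by simp [cross]
  | k + 1 => by rw [← add_assoc, cross, cross_add k, cross, mul_assoc, add_assoc]

theorem block_mul_cross {o m k p : ℕ} (hp : o + m + k ≤ p) : ∀ l : ℕ,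
    (block o m k * cross p l : BraidGroup n) = cross p l * block o m k
  | 0 => by simp [cross]
  | l + 1 => by
    rw [cross, ← mul_assoc, ← block_comm (by omega), mul_assoc, block_mul_cross hp l, mul_assoc]

theorem block_add_left {o m k : ℕ} : ∀ l : ℕ,
    (block o (m + k) l : BraidGroup n) = block (o + m) k l * block o m l
  | 0 => by simp [block]
  | l + 1 => by
    rw [block, block_add_left l, cross_add, block, block, mul_assoc, ← mul_assoc (block o m l),
      block_mul_cross (by omega), show o + m + l = o + l + m by omega]
    simp only [mul_assoc]

theorem emb_cross {d N : ℕ} (h : d + n ≤ N) {o : ℕ} : ∀ {m : ℕ}, o + m < n →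
    emb d N h (cross o m) = cross (d + o) m
  | 0, _ => map_one _
  | m + 1, hm => by
    rw [cross, map_mul, emb_cross h (by omega), emb_σ h (by omega), cross, add_assoc]

theorem emb_block {d N : ℕ} (h : d + n ≤ N) {o m : ℕ} : ∀ {k : ℕ}, o + m + k ≤ n →
    emb d N h (block o m k) = block (d + o) m k
  | 0, _ => map_one _
  | k + 1, hk => by
    rw [block, map_mul, emb_block h (by omega), emb_cross h (by omega), block, add_assoc]

end BraidGroup

section Braids

open BraidGroup

/-- The free braided strict monoidal category on one object: its objects are the natural numbers. -/
@[ext]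
structure BraidCat : Type where
  strands : ℕ

namespace BraidCat

/-- The morphisms `m ⟶ n`: the braids on `m` strands if `m = n`, and none otherwise. -/
@[ext]
structure Hom (m n : BraidCat) : Type where
  eq : m.strands = n.strands
  braid : BraidGroup m.strands

instance : Category BraidCat where
  Hom := Hom
  id _ := ⟨rfl, 1⟩
  comp {m _ _} f g :=
    ⟨f.eq.trans g.eq, f.braid * emb 0 m.strands (by rw [f.eq, zero_add]) g.braid⟩
  id_comp f := Hom.ext (by simp [emb_self])
  comp_id f := Hom.ext (by simp)
  assoc f g h := Hom.ext (by
    rw [map_mul, emb_emb _ _ _ rfl, mul_assoc])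

theorem hom_ext {m n : BraidCat} {f g : m ⟶ n} (h : f.braid = g.braid) : f = g := Hom.ext h

@[simp] theorem id_braid (m : BraidCat) : Hom.braid (𝟙 m) = 1 := rfl

@[simp] theorem comp_braid {m n k : BraidCat} (f : m ⟶ n) (g : n ⟶ k) :
    Hom.braid (f ≫ g) = f.braid * emb 0 m.strands (by rw [f.eq, zero_add]) g.braid := rfl

/-- Isomorphisms from equalities of objects and braids. -/
def isoMk {m n : BraidCat} (h : m.strands = n.strands) (b : BraidGroup m.strands) : m ≅ n where
  hom := ⟨h, b⟩
  inv := ⟨h.symm, emb 0 n.strands (by rw [h, zero_add]) b⁻¹⟩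
  hom_inv_id := hom_ext (by
    simp only [comp_braid]
    rw [emb_emb _ _ (by simp) rfl, emb_self, mul_inv_cancel]
    rfl)
  inv_hom_id := hom_ext (by
    simp only [comp_braid]
    rw [← map_mul, inv_mul_cancel, map_one]
    rfl)

@[simp] theorem isoMk_hom_braid {m n : BraidCat} (h : m.strands = n.strands)
    (b : BraidGroup m.strands) : (isoMk h b).hom.braid = b := rfl

@[simp] theorem isoMk_inv_braid {m n : BraidCat} (h : m.strands = n.strands)
    (b : BraidGroup m.strands) :
    (isoMk h b).inv.braid = emb 0 n.strands (by rw [h, zero_add]) b⁻¹ := rfl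

/-- Juxtaposition of braids. -/
def juxt {m n m' n' : BraidCat} (f : m ⟶ m') (g : n ⟶ n') :
    (⟨m.strands + n.strands⟩ : BraidCat) ⟶ ⟨m'.strands + n'.strands⟩ where
  eq := by rw [f.eq, g.eq]
  braid := emb 0 _ (by omega) f.braid * emb m.strands _ le_rfl g.braid

instance : MonoidalCategoryStruct BraidCat where
  tensorObj m n := ⟨m.strands + n.strands⟩
  tensorUnit := ⟨0⟩
  tensorHom f g := juxt f g
  whiskerLeft m _ _ g := juxt (𝟙 m) g
  whiskerRight f n := juxt f (𝟙 n)
  associator _ _ _ := isoMk (add_assoc _ _ _) 1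
  leftUnitor _ := isoMk (zero_add _) 1
  rightUnitor _ := isoMk (add_zero _) 1

open MonoidalCategory

@[simp] theorem tensorObj_strands (m n : BraidCat) : (m ⊗ n).strands = m.strands + n.strands := rfl

@[simp] theorem unit_strands : (𝟙_ BraidCat).strands = 0 := rfl

@[simp] theorem tensorHom_braid {m n m' n' : BraidCat} (f : m ⟶ m') (g : n ⟶ n') :
    Hom.braid (f ⊗ₘ g) = emb 0 (m.strands + n.strands) (by omega) f.braid *
      emb m.strands (m.strands + n.strands) le_rfl g.braid := rfl

@[simp] theorem whiskerLeft_braid (m : BraidCat) {n n' : BraidCat} (g : n ⟶ n') :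
    Hom.braid (m ◁ g) = emb m.strands (m.strands + n.strands) le_rfl g.braid := by
  change emb 0 _ _ 1 * _ = _
  rw [map_one, one_mul]

@[simp] theorem whiskerRight_braid {m m' : BraidCat} (f : m ⟶ m') (n : BraidCat) :
    Hom.braid (f ▷ n) = emb 0 (m.strands + n.strands) (by omega) f.braid := by
  change _ * emb _ _ _ 1 = _
  rw [map_one, mul_one]

@[simp] theorem associator_hom_braid (m n k : BraidCat) : Hom.braid (α_ m n k).hom = 1 := rfl

@[simp] theorem associator_inv_braid (m n k : BraidCat) : Hom.braid (α_ m n k).inv = 1 :=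
  (isoMk_inv_braid _ _).trans (by rw [inv_one, map_one])

@[simp] theorem leftUnitor_hom_braid (m : BraidCat) : Hom.braid (λ_ m).hom = 1 := rfl

@[simp] theorem rightUnitor_hom_braid (m : BraidCat) : Hom.braid (ρ_ m).hom = 1 := rfl

instance : MonoidalCategory BraidCat := .ofTensorHom
  (id_tensorHom_id := fun _ _ => hom_ext (by simp))
  (id_tensorHom := fun _ _ _ _ => rfl)
  (tensorHom_id := fun _ _ => rfl)
  (tensorHom_comp_tensorHom := fun {X₁ Y₁ Z₁ X₂ Y₂ Z₂} f₁ f₂ g₁ g₂ => hom_ext (by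
    have h₁ := Hom.eq f₁
    have h₂ := Hom.eq f₂
    have h₃ : X₁.strands + Y₂.strands ≤ X₁.strands + X₂.strands := by omega
    have h₄ : 0 + Y₁.strands ≤ X₁.strands + X₂.strands := by omega
    simp only [comp_braid, tensorHom_braid, map_mul, tensorObj_strands]
    rw [emb_emb _ _ h₄ rfl, emb_emb _ _ h₃ (by omega), emb_emb _ _ h₄ rfl, emb_emb _ _ h₃ rfl,
      mul_assoc, mul_assoc, ← mul_assoc (emb X₁.strands _ _ _), ← emb_comm _ _ (by omega),
      mul_assoc]))
  (associator_naturality := fun f₁ f₂ f₃ => hom_ext (by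
    simp only [comp_braid, tensorHom_braid, map_mul, tensorObj_strands, associator_hom_braid,
      map_one, mul_one, one_mul]
    rw [emb_emb _ _ (by omega) rfl, emb_emb _ _ (by omega) rfl, emb_emb _ _ (by omega) rfl,
      emb_emb _ _ (by omega) rfl, emb_emb _ _ (by omega) rfl, emb_emb _ _ (by omega) rfl,
      emb_emb _ _ (by omega) rfl]
    simp only [zero_add, add_zero, mul_assoc]))
  (leftUnitor_naturality := fun f => hom_ext (by
    simp only [comp_braid, tensorHom_braid, id_braid, leftUnitor_hom_braid, map_one, mul_one,
      one_mul, unit_strands, tensorObj_strands]))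
  (rightUnitor_naturality := fun f => hom_ext (by
    simp only [comp_braid, tensorHom_braid, id_braid, rightUnitor_hom_braid, map_one, mul_one,
      one_mul, unit_strands, tensorObj_strands]))
  (pentagon := fun _ _ _ _ => hom_ext (by simp))
  (triangle := fun _ _ => hom_ext (by simp))

/-- The braiding moves the last `n` of `m + n` strands, in order, past the first `m`. -/
def braid (m n : BraidCat) : m ⊗ n ≅ n ⊗ m :=
  isoMk (add_comm _ _) (block 0 m.strands n.strands)

@[simp] theorem braid_hom_braid (m n : BraidCat) :
    Hom.braid (braid m n).hom = block 0 m.strands n.strands := rfl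

instance : BraidedCategory BraidCat where
  braiding := braid
  braiding_naturality_right m {n n'} f := hom_ext (by
    have h := Hom.eq f
    simp only [comp_braid, whiskerLeft_braid, whiskerRight_braid, braid_hom_braid,
      tensorObj_strands]
    rw [emb_emb _ _ (by omega) rfl, emb_block _ (by omega), ← h]
    refine eq_of_conj _ (fun i hi => ?_) _
    rw [emb_σ _ hi, emb_σ _ hi]
    have := σ_mul_block_right (n := m.strands + n.strands) (o := 0) (m := m.strands) hi (by omega)
    simpa using this)
  braiding_naturality_left {m m'} f n := hom_ext (by
    have h := Hom.eq f
    simp only [comp_braid, whiskerLeft_braid, whiskerRight_braid, braid_hom_braid,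
      tensorObj_strands]
    rw [emb_emb _ _ (by omega) rfl, emb_block _ (by omega), ← h]
    refine eq_of_conj _ (fun i hi => ?_) _
    rw [emb_σ _ hi, emb_σ _ hi]
    have := σ_mul_block_left (n := m.strands + n.strands) (o := 0) (i := i) (m := m.strands)
      (k := n.strands) (by omega) (by omega) (by omega)
    simpa [add_comm i] using this)
  hexagon_forward m n k := hom_ext (by
    simp only [comp_braid, whiskerLeft_braid, whiskerRight_braid, braid_hom_braid,
      associator_hom_braid, map_one, mul_one, one_mul, tensorObj_strands]
    rw [emb_block _ (by omega), emb_block _ (by omega), emb_block _ (by omega),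
      emb_block _ (by omega), emb_block _ (by omega), block_add]
    simp)
  hexagon_reverse m n k := hom_ext (by
    simp only [comp_braid, whiskerLeft_braid, whiskerRight_braid, braid_hom_braid,
      associator_inv_braid, map_one, mul_one, one_mul, tensorObj_strands]
    rw [emb_block _ (by omega), emb_block _ (by omega), emb_block _ (by omega),
      emb_block _ (by omega), emb_block _ (by omega), block_add_left]
    simp)

end BraidCat

end Braids

section BraidedComp
open MonoidalCategory CategoryTheory.Prod

universe v u

section
variable {C : Type u} [Category.{v} C] [MonoidalCategory C] [BraidedCategory C]

theorem tensorδ_whiskerLeft (X₁ X₂ : C) {Y₁ Y₂ Z₁ Z₂ : C} (f₁ : Y₁ ⟶ Z₁) (f₂ : Y₂ ⟶ Z₂) :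
    (X₁ ◁ f₁) ⊗ₘ (X₂ ◁ f₂) =
      tensorδ X₁ X₂ Y₁ Y₂ ≫ (X₁ ⊗ X₂) ◁ (f₁ ⊗ₘ f₂) ≫ tensorμ X₁ X₂ Z₁ Z₂ := by
  rw [tensorμ_natural_right, tensorδ_tensorμ_assoc]

theorem tensorδ_whiskerRight {X₁ X₂ Y₁ Y₂ : C} (f₁ : X₁ ⟶ Y₁) (f₂ : X₂ ⟶ Y₂) (Z₁ Z₂ : C) :
    (f₁ ▷ Z₁) ⊗ₘ (f₂ ▷ Z₂) =
      tensorδ X₁ X₂ Z₁ Z₂ ≫ (f₁ ⊗ₘ f₂) ▷ (Z₁ ⊗ Z₂) ≫ tensorμ Y₁ Y₂ Z₁ Z₂ := by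
  rw [tensorμ_natural_left, tensorδ_tensorμ_assoc]

theorem tensorδ_associator (X₁ X₂ Y₁ Y₂ Z₁ Z₂ : C) :
    (α_ X₁ Y₁ Z₁).hom ⊗ₘ (α_ X₂ Y₂ Z₂).hom =
      tensorδ (X₁ ⊗ Y₁) (X₂ ⊗ Y₂) Z₁ Z₂ ≫ tensorδ X₁ X₂ Y₁ Y₂ ▷ (Z₁ ⊗ Z₂) ≫
        (α_ (X₁ ⊗ X₂) (Y₁ ⊗ Y₂) (Z₁ ⊗ Z₂)).hom ≫ (X₁ ⊗ X₂) ◁ tensorμ Y₁ Y₂ Z₁ Z₂ ≫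
        tensorμ X₁ X₂ (Y₁ ⊗ Z₁) (Y₂ ⊗ Z₂) := by
  rw [← tensor_associativity, ← comp_whiskerRight_assoc, tensorδ_tensorμ, id_whiskerRight,
    Category.id_comp, tensorδ_tensorμ_assoc]

theorem tensorδ_leftUnitor (X₁ X₂ : C) :
    (λ_ X₁).hom ⊗ₘ (λ_ X₂).hom =
      tensorδ (𝟙_ C) (𝟙_ C) X₁ X₂ ≫ (λ_ (𝟙_ C)).hom ▷ (X₁ ⊗ X₂) ≫ (λ_ (X₁ ⊗ X₂)).hom := by
  rw [tensor_left_unitality, ← comp_whiskerRight_assoc, Iso.hom_inv_id, id_whiskerRight,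
    Category.id_comp, tensorδ_tensorμ_assoc]

theorem tensorδ_rightUnitor (X₁ X₂ : C) :
    (ρ_ X₁).hom ⊗ₘ (ρ_ X₂).hom =
      tensorδ X₁ X₂ (𝟙_ C) (𝟙_ C) ≫ (X₁ ⊗ X₂) ◁ (λ_ (𝟙_ C)).hom ≫ (ρ_ (X₁ ⊗ X₂)).hom := by
  rw [tensor_right_unitality, ← whiskerLeft_comp_assoc, Iso.hom_inv_id, whiskerLeft_id,
    Category.id_comp, tensorδ_tensorμ_assoc]

end

open Bicategory in
/-- For a braided monoidal category `C`, the tensor product as a pseudofunctor of two variables on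
the one-object bicategory of `C` (whose 1-cells are the objects of `C`, composed by `⊗`). The
comparison of `(X₁ ⊗ X₂) ⊗ (Y₁ ⊗ Y₂)` with `(X₁ ⊗ Y₁) ⊗ (X₂ ⊗ Y₂)` is the braiding
`X₂ ⊗ Y₁ ⟶ Y₁ ⊗ X₂` of the inner factors. -/
def braidedComp (C : Type u) [Category.{v} C] [MonoidalCategory C] [BraidedCategory C] :
    (MonoidalSingleObj C × MonoidalSingleObj C) ⥤ᵖ MonoidalSingleObj C where
  obj _ := MonoidalSingleObj.star C
  map f := tensorObj (C := C) f.1 f.2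
  map₂ η := tensorHom (C := C) η.1 η.2
  map₂_id _ := id_tensorHom_id (C := C) _ _
  map₂_comp _ _ := (tensorHom_comp_tensorHom (C := C) _ _ _ _).symm
  mapId _ := leftUnitor (C := C) (tensorUnit C)
  mapComp f g :=
    { hom := tensorδ (C := C) f.1 f.2 g.1 g.2
      inv := tensorμ (C := C) f.1 f.2 g.1 g.2
      hom_inv_id := tensorδ_tensorμ (C := C) _ _ _ _
      inv_hom_id := tensorμ_tensorδ (C := C) _ _ _ _ }
  map₂_whisker_left _ _ _ _ := tensorδ_whiskerLeft (C := C) _ _ _ _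
  map₂_whisker_right _ _ := tensorδ_whiskerRight (C := C) _ _ _ _
  map₂_associator _ _ _ := tensorδ_associator (C := C) _ _ _ _ _ _
  map₂_left_unitor _ := tensorδ_leftUnitor (C := C) _ _
  map₂_right_unitor _ := tensorδ_rightUnitor (C := C) _ _

end BraidedComp

section Tri

universe u

section Bicat

open Bicategory CategoryTheory.Prod

variable {A B C D : Type u} [Bicategory.{u, u} A] [Bicategory.{u, u} B] [Bicategory.{u, u} C]
  [Bicategory.{u, u} D]

/-- The product of two pseudofunctors. -/
def prodMap (F : A ⥤ᵖ B) (G : C ⥤ᵖ D) : (A × C) ⥤ᵖ (B × D) where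
  obj X := (F.obj X.1, G.obj X.2)
  map f := F.map f.1 ×ₘ G.map f.2
  map₂ η := F.map₂ η.1 ×ₘ G.map₂ η.2
  map₂_id _ := Prod.ext (F.map₂_id _) (G.map₂_id _)
  map₂_comp _ _ := Prod.ext (F.map₂_comp _ _) (G.map₂_comp _ _)
  mapId X := Iso.prod (F.mapId X.1) (G.mapId X.2)
  mapComp f g := Iso.prod (F.mapComp f.1 g.1) (G.mapComp f.2 g.2)
  map₂_whisker_left _ _ _ _ := Prod.ext (F.map₂_whisker_left _ _) (G.map₂_whisker_left _ _)
  map₂_whisker_right _ _ := Prod.ext (F.map₂_whisker_right _ _) (G.map₂_whisker_right _ _)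
  map₂_associator _ _ _ := Prod.ext (F.map₂_associator _ _ _) (G.map₂_associator _ _ _)
  map₂_left_unitor _ := Prod.ext (F.map₂_left_unitor _) (G.map₂_left_unitor _)
  map₂_right_unitor _ := Prod.ext (F.map₂_right_unitor _) (G.map₂_right_unitor _)

variable (A B C) in
/-- Reassociation of a product of three bicategories. -/
def prodAssoc : ((A × B) × C) ⥤ᵖ (A × (B × C)) where
  obj X := (X.1.1, (X.1.2, X.2))
  map f := f.1.1 ×ₘ (f.1.2 ×ₘ f.2)
  map₂ η := η.1.1 ×ₘ (η.1.2 ×ₘ η.2)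
  mapId _ := Iso.refl _
  mapComp _ _ := Iso.refl _

/-- The terminal bicategory. -/
abbrev OneBicat : Type u := LocallyDiscrete (Discrete PUnit.{u + 1})

/-- Its object. -/
abbrev OneBicat.star : OneBicat.{u} := ⟨⟨⟨⟩⟩⟩

/-- Squares that commute up to an isomorphism are pasted along a common side. -/
def paste {x₀ x₁ x₂ y₀ y₁ y₂ : A} {f : x₀ ⟶ y₀} {f' : x₁ ⟶ y₁} {f'' : x₂ ⟶ y₂} {x : x₀ ⟶ x₁}
    {x' : x₁ ⟶ x₂} {y : y₀ ⟶ y₁} {y' : y₁ ⟶ y₂} (S : f ≫ y ≅ x ≫ f') (T : f' ≫ y' ≅ x' ≫ f'') :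
    f ≫ y ≫ y' ≅ (x ≫ x') ≫ f'' :=
  (α_ _ _ _).symm ≪≫ whiskerRightIso S y' ≪≫ α_ _ _ _ ≪≫ whiskerLeftIso x T ≪≫ (α_ _ _ _).symm

/-- The identity square of a 1-cell. -/
def idSq {x y : A} (f : x ⟶ y) : f ≫ 𝟙 y ≅ 𝟙 x ≫ f := ρ_ f ≪≫ (λ_ f).symm

/-- The image under a pseudofunctor of two variables of a pair of squares. -/
def mapSq (F : (A × B) ⥤ᵖ C) {x x' y y' : A} {f : x ⟶ y} {f' : x' ⟶ y'} {p : x ⟶ x'} {q : y ⟶ y'}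
    {z z' w w' : B} {g : z ⟶ w} {g' : z' ⟶ w'} {r : z ⟶ z'} {s : w ⟶ w'}
    (S : f ≫ q ≅ p ≫ f') (T : g ≫ s ≅ r ≫ g') :
    F.map (f ×ₘ g) ≫ F.map (q ×ₘ s) ≅ F.map (p ×ₘ r) ≫ F.map (f' ×ₘ g') :=
  (F.mapComp (f ×ₘ g) (q ×ₘ s)).symm ≪≫ F.map₂Iso (Iso.prod S T) ≪≫ F.mapComp (p ×ₘ r) (f' ×ₘ g')

/-- The image of a composite of three 1-cells under a pseudofunctor. -/
def mapComp₃ (F : A ⥤ᵖ B) {x y z w : A} (f : x ⟶ y) (g : y ⟶ z) (h : z ⟶ w) :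
    F.map (f ≫ g ≫ h) ≅ F.map f ≫ F.map g ≫ F.map h :=
  F.mapComp f (g ≫ h) ≪≫ whiskerLeftIso (F.map f) (F.mapComp g h)

end Bicat

open Bicategory CategoryTheory.Prod
open scoped Pseudofunctor.StrongTrans

/-- The objects `Obj`, the hom-bicategories `Hom a b`, the composition, the units and the
associativity and unit adjoint equivalences of a tricategory. Composition is written in the
order `g ⊗ f` for `f : Hom a b` and `g : Hom b c`. -/
structure TriData (Obj : Type u) (Hom : Obj → Obj → Type u) [∀ a b, Bicategory.{u, u} (Hom a b)] where
  comp (a b c : Obj) : (Hom b c × Hom a b) ⥤ᵖ Hom a c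
  unit (a : Obj) : OneBicat.{u} ⥤ᵖ Hom a a
  assoc (a b c d : Obj) : Bicategory.Equivalence
    ((prodMap (comp b c d) (.id (Hom a b))).comp (comp a b d))
    ((prodAssoc (Hom c d) (Hom b c) (Hom a b)).comp
      ((prodMap (.id (Hom c d)) (comp a b c)).comp (comp a c d)))
  left (a b : Obj) : Bicategory.Equivalence
    ((Bicategory.Prod.sectR OneBicat.star (Hom a b)).toPseudofunctor.comp
      ((prodMap (unit b) (.id (Hom a b))).comp (comp a b b)))
    (Pseudofunctor.id (Hom a b))
  right (a b : Obj) : Bicategory.Equivalence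
    ((Bicategory.Prod.sectL (Hom a b) OneBicat.star).toPseudofunctor.comp
      ((prodMap (.id (Hom a b)) (unit a)).comp (comp a a b)))
    (Pseudofunctor.id (Hom a b))

namespace TriData

variable {Obj : Type u} {Hom : Obj → Obj → Type u} [∀ a b, Bicategory.{u, u} (Hom a b)]
  (D : TriData Obj Hom) {a b c d e : Obj}

/-- `g ⊗ f`. -/
abbrev o (g : Hom b c) (f : Hom a b) : Hom a c := (D.comp a b c).obj (g, f)

/-- `γ ⊗ φ`, for 2-cells. -/
abbrev m {g g' : Hom b c} {f f' : Hom a b} (γ : g ⟶ g') (φ : f ⟶ f') : D.o g f ⟶ D.o g' f' :=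
  (D.comp a b c).map (γ ×ₘ φ)

variable (a) in
/-- The unit 1-cell. -/
abbrev I : Hom a a := (D.unit a).obj OneBicat.star

variable (a) in
/-- The 2-cell of the unit. -/
abbrev ι : D.I a ⟶ D.I a := (D.unit a).map (𝟙 OneBicat.star)

/-- `- ⊗ f`. -/
abbrev R (c : Obj) (f : Hom a b) : Hom b c ⥤ᵖ Hom a c :=
  (Bicategory.Prod.sectL (Hom b c) f).toPseudofunctor.comp (D.comp a b c)

/-- `g ⊗ -`. -/
abbrev L (a : Obj) (g : Hom b c) : Hom a b ⥤ᵖ Hom a c :=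
  (Bicategory.Prod.sectR g (Hom a b)).toPseudofunctor.comp (D.comp a b c)

/-- The associativity 2-cell `(h ⊗ g) ⊗ f ⟶ h ⊗ (g ⊗ f)`. -/
def A (h : Hom c d) (g : Hom b c) (f : Hom a b) : D.o (D.o h g) f ⟶ D.o h (D.o g f) :=
  (D.assoc a b c d).hom.app ((h, g), f)

/-- The left unit 2-cell `I ⊗ f ⟶ f`. -/
def l (f : Hom a b) : D.o (D.I b) f ⟶ f := (D.left a b).hom.app f

/-- The adjoint inverse `f ⟶ f ⊗ I` of the right unit 2-cell. -/
def r' (f : Hom a b) : f ⟶ D.o f (D.I a) := (D.right a b).inv.app f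

/-- Naturality of `A`. -/
def natA {h h' : Hom c d} {g g' : Hom b c} {f f' : Hom a b} (χ : h ⟶ h') (γ : g ⟶ g')
    (φ : f ⟶ f') :
    D.m (D.m χ γ) φ ≫ D.A h' g' f' ≅ D.A h g f ≫ D.m χ (D.m γ φ) :=
  (D.assoc a b c d).hom.naturality ((χ ×ₘ γ) ×ₘ φ)

/-- Naturality of `l`. -/
def natL {f f' : Hom a b} (φ : f ⟶ f') : D.m (D.ι b) φ ≫ D.l f' ≅ D.l f ≫ φ :=
  (D.left a b).hom.naturality φ

/-- Naturality of `r'`. -/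
def natR' {f f' : Hom a b} (φ : f ⟶ f') : φ ≫ D.r' f' ≅ D.r' f ≫ D.m φ (D.ι a) :=
  (D.right a b).inv.naturality φ

/-- Naturality of `A` in its first variable. -/
def natA₁ {h h' : Hom c d} (χ : h ⟶ h') (g : Hom b c) (f : Hom a b) :
    D.m (D.m χ (𝟙 g)) (𝟙 f) ≫ D.A h' g f ≅ D.A h g f ≫ D.m χ (𝟙 (D.o g f)) :=
  D.natA χ (𝟙 g) (𝟙 f) ≪≫ whiskerLeftIso (D.A h g f)
    ((D.comp a c d).map₂Iso (Iso.prod (Iso.refl χ) ((D.comp a b c).mapId (g, f))))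

/-- Naturality of `A` in its second variable. -/
def natA₂ (h : Hom c d) {g g' : Hom b c} (γ : g ⟶ g') (f : Hom a b) :
    D.m (D.m (𝟙 h) γ) (𝟙 f) ≫ D.A h g' f ≅ D.A h g f ≫ D.m (𝟙 h) (D.m γ (𝟙 f)) :=
  D.natA (𝟙 h) γ (𝟙 f)

/-- Naturality of `A` in its third variable. -/
def natA₃ (h : Hom c d) (g : Hom b c) {f f' : Hom a b} (φ : f ⟶ f') :
    D.m (𝟙 (D.o h g)) φ ≫ D.A h g f' ≅ D.A h g f ≫ D.m (𝟙 h) (D.m (𝟙 g) φ) :=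
  whiskerRightIso ((D.comp a b d).map₂Iso (Iso.prod ((D.comp b c d).mapId (h, g)).symm
    (Iso.refl φ))) (D.A h g f') ≪≫ D.natA (𝟙 h) (𝟙 g) φ

end TriData

/-- The remaining data of a tricategory: the components of the four invertible modifications. -/
structure TriModData (Obj : Type u) (Hom : Obj → Obj → Type u)
    [∀ a b, Bicategory.{u, u} (Hom a b)] extends TriData Obj Hom where
  π {a b c d e : Obj} (k : Hom d e) (h : Hom c d) (g : Hom b c) (f : Hom a b) :
    toTriData.m (toTriData.A k h g) (𝟙 f) ≫ toTriData.A k (toTriData.o h g) f ≫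
        toTriData.m (𝟙 k) (toTriData.A h g f) ≅
      toTriData.A (toTriData.o k h) g f ≫ toTriData.A k h (toTriData.o g f)
  μ {a b c : Obj} (g : Hom b c) (f : Hom a b) :
    toTriData.m (toTriData.r' g) (𝟙 f) ≫ toTriData.A g (toTriData.I b) f ≫
        toTriData.m (𝟙 g) (toTriData.l f) ≅
      𝟙 (toTriData.o g f)
  lam {a b c : Obj} (g : Hom b c) (f : Hom a b) :
    toTriData.m (toTriData.l g) (𝟙 f) ≅
      toTriData.A (toTriData.I c) g f ≫ toTriData.l (toTriData.o g f)
  rho {a b c : Obj} (g : Hom b c) (f : Hom a b) :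
    toTriData.m (𝟙 g) (toTriData.r' f) ≅
      toTriData.r' (toTriData.o g f) ≫ toTriData.A g f (toTriData.I a)

namespace TriModData

variable {Obj : Type u} {Hom : Obj → Obj → Type u} [∀ a b, Bicategory.{u, u} (Hom a b)]
  (D : TriModData Obj Hom) {a b c d e z : Obj}

/-- `π ⊗ f`. -/
def πR (p : Hom d e) (q : Hom c d) (r : Hom b c) (s : Hom a b) (t : Hom z a) :
    D.m (D.m (D.A p q r) (𝟙 s)) (𝟙 t) ≫ D.m (D.A p (D.o q r) s) (𝟙 t) ≫
        D.m (D.m (𝟙 p) (D.A q r s)) (𝟙 t) ≅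
      D.m (D.A (D.o p q) r s) (𝟙 t) ≫ D.m (D.A p q (D.o r s)) (𝟙 t) :=
  (mapComp₃ (D.R e t) _ _ _).symm ≪≫ (D.R e t).map₂Iso (D.π p q r s) ≪≫ (D.R e t).mapComp _ _

/-- `p ⊗ π`. -/
def πL (p : Hom d e) (q : Hom c d) (r : Hom b c) (s : Hom a b) (t : Hom z a) :
    D.m (𝟙 p) (D.m (D.A q r s) (𝟙 t)) ≫ D.m (𝟙 p) (D.A q (D.o r s) t) ≫
        D.m (𝟙 p) (D.m (𝟙 q) (D.A r s t)) ≅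
      D.m (𝟙 p) (D.A (D.o q r) s t) ≫ D.m (𝟙 p) (D.A q r (D.o s t)) :=
  (mapComp₃ (D.L z p) _ _ _).symm ≪≫ (D.L z p).map₂Iso (D.π q r s t) ≪≫ (D.L z p).mapComp _ _

/-- `μ ⊗ f`. -/
def μR (h : Hom c d) (g : Hom b c) (f : Hom a b) :
    D.m (D.m (D.r' h) (𝟙 g)) (𝟙 f) ≫ D.m (D.A h (D.I c) g) (𝟙 f) ≫
        D.m (D.m (𝟙 h) (D.l g)) (𝟙 f) ≅ 𝟙 (D.o (D.o h g) f) :=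
  (mapComp₃ (D.R d f) _ _ _).symm ≪≫ (D.R d f).map₂Iso (D.μ h g) ≪≫ (D.R d f).mapId _

/-- `h ⊗ μ`. -/
def μL (h : Hom c d) (g : Hom b c) (f : Hom a b) :
    D.m (𝟙 h) (D.m (D.r' g) (𝟙 f)) ≫ D.m (𝟙 h) (D.A g (D.I b) f) ≫
        D.m (𝟙 h) (D.m (𝟙 g) (D.l f)) ≅ 𝟙 (D.o h (D.o g f)) :=
  (mapComp₃ (D.L a h) _ _ _).symm ≪≫ (D.L a h).map₂Iso (D.μ g f) ≪≫ (D.L a h).mapId _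

/-- `h ⊗ lam`. -/
def lamL (h : Hom c d) (g : Hom b c) (f : Hom a b) :
    D.m (𝟙 h) (D.m (D.l g) (𝟙 f)) ≅
      D.m (𝟙 h) (D.A (D.I c) g f) ≫ D.m (𝟙 h) (D.l (D.o g f)) :=
  (D.L a h).map₂Iso (D.lam g f) ≪≫ (D.L a h).mapComp _ _

/-- `rho ⊗ f`. -/
def rhoR (h : Hom c d) (g : Hom b c) (f : Hom a b) :
    D.m (D.m (𝟙 h) (D.r' g)) (𝟙 f) ≅
      D.m (D.r' (D.o h g)) (𝟙 f) ≫ D.m (D.A h g (D.I b)) (𝟙 f) :=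
  (D.R d f).map₂Iso (D.rho h g) ≪≫ (D.R d f).mapComp _ _

/-- `π` is a modification. -/
def PiNatural : Prop :=
  ∀ {a b c d e : Obj} {k k' : Hom d e} {h h' : Hom c d} {g g' : Hom b c} {f f' : Hom a b}
    (κ : k ⟶ k') (χ : h ⟶ h') (γ : g ⟶ g') (φ : f ⟶ f'),
    D.m (D.m (D.m κ χ) γ) φ ◁ (D.π k' h' g' f').hom ≫
        (paste (D.natA (D.m κ χ) γ φ) (D.natA κ χ (D.m γ φ))).hom =
      (paste (mapSq (D.comp a b e) (D.natA κ χ γ) (idSq φ))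
          (paste (D.natA κ (D.m χ γ) φ) (mapSq (D.comp a d e) (idSq κ) (D.natA χ γ φ)))).hom ≫
        (D.π k h g f).hom ▷ D.m κ (D.m χ (D.m γ φ))

/-- `μ` is a modification. -/
def MuNatural : Prop :=
  ∀ {a b c : Obj} {g g' : Hom b c} {f f' : Hom a b} (γ : g ⟶ g') (φ : f ⟶ f'),
    D.m γ φ ◁ (D.μ g' f').hom ≫ (idSq (D.m γ φ)).hom =
      (paste (mapSq (D.comp a b c) (D.natR' γ) (idSq φ))
          (paste (D.natA γ (D.ι b) φ) (mapSq (D.comp a b c) (idSq γ) (D.natL φ)))).hom ≫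
        (D.μ g f).hom ▷ D.m γ φ

/-- `lam` is a modification. -/
def LamNatural : Prop :=
  ∀ {a b c : Obj} {g g' : Hom b c} {f f' : Hom a b} (γ : g ⟶ g') (φ : f ⟶ f'),
    D.m (D.m (D.ι c) γ) φ ◁ (D.lam g' f').hom ≫
        (paste (D.natA (D.ι c) γ φ) (D.natL (D.m γ φ))).hom =
      (mapSq (D.comp a b c) (D.natL γ) (idSq φ)).hom ≫ (D.lam g f).hom ▷ D.m γ φ

/-- `rho` is a modification. -/
def RhoNatural : Prop :=
  ∀ {a b c : Obj} {g g' : Hom b c} {f f' : Hom a b} (γ : g ⟶ g') (φ : f ⟶ f'),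
    D.m γ φ ◁ (D.rho g' f').hom ≫ (paste (D.natR' (D.m γ φ)) (D.natA γ φ (D.ι a))).hom =
      (mapSq (D.comp a b c) (idSq γ) (D.natR' φ)).hom ≫
        (D.rho g f).hom ▷ D.m γ (D.m φ (D.ι a))

/-- The associativity axiom (nonabelian 4-cocycle condition): the two ways round the
associahedron agree. Here `⊗≫` is composition up to the constraints of a hom-bicategory. -/
def Cocycle : Prop :=
  ∀ {z a b c d e : Obj} (p : Hom d e) (q : Hom c d) (r : Hom b c) (s : Hom a b) (t : Hom z a),
    𝟙 (D.m (D.m (D.A p q r) (𝟙 s)) (𝟙 t) ≫ D.m (D.A p (D.o q r) s) (𝟙 t) ≫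
        D.m (D.m (𝟙 p) (D.A q r s)) (𝟙 t) ≫ D.A p (D.o q (D.o r s)) t ≫
        D.m (𝟙 p) (D.A q (D.o r s) t) ≫ D.m (𝟙 p) (D.m (𝟙 q) (D.A r s t))) ⊗≫
      (D.πR p q r s t).hom ▷ (D.A p (D.o q (D.o r s)) t ≫ D.m (𝟙 p) (D.A q (D.o r s) t) ≫
        D.m (𝟙 p) (D.m (𝟙 q) (D.A r s t))) ⊗≫
      D.m (D.A (D.o p q) r s) (𝟙 t) ◁ (D.π p q (D.o r s) t).hom ▷
        D.m (𝟙 p) (D.m (𝟙 q) (D.A r s t)) ⊗≫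
      (D.m (D.A (D.o p q) r s) (𝟙 t) ≫ D.A (D.o p q) (D.o r s) t) ◁
        (D.natA₃ p q (D.A r s t)).inv ⊗≫
      (D.π (D.o p q) r s t).hom ▷ D.A p q (D.o r (D.o s t)) ⊗≫
      𝟙 (D.A (D.o (D.o p q) r) s t ≫ D.A (D.o p q) r (D.o s t) ≫ D.A p q (D.o r (D.o s t))) =
    𝟙 (D.m (D.m (D.A p q r) (𝟙 s)) (𝟙 t) ≫ D.m (D.A p (D.o q r) s) (𝟙 t) ≫
        D.m (D.m (𝟙 p) (D.A q r s)) (𝟙 t) ≫ D.A p (D.o q (D.o r s)) t ≫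
        D.m (𝟙 p) (D.A q (D.o r s) t) ≫ D.m (𝟙 p) (D.m (𝟙 q) (D.A r s t))) ⊗≫
      (D.m (D.m (D.A p q r) (𝟙 s)) (𝟙 t) ≫ D.m (D.A p (D.o q r) s) (𝟙 t)) ◁
        (D.natA₂ p (D.A q r s) t).hom ▷
        (D.m (𝟙 p) (D.A q (D.o r s) t) ≫ D.m (𝟙 p) (D.m (𝟙 q) (D.A r s t))) ⊗≫
      (D.m (D.m (D.A p q r) (𝟙 s)) (𝟙 t) ≫ D.m (D.A p (D.o q r) s) (𝟙 t) ≫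
        D.A p (D.o (D.o q r) s) t) ◁ (D.πL p q r s t).hom ⊗≫
      D.m (D.m (D.A p q r) (𝟙 s)) (𝟙 t) ◁ (D.π p (D.o q r) s t).hom ▷
        D.m (𝟙 p) (D.A q r (D.o s t)) ⊗≫
      (D.natA₁ (D.A p q r) s t).hom ▷
        (D.A p (D.o q r) (D.o s t) ≫ D.m (𝟙 p) (D.A q r (D.o s t))) ⊗≫
      D.A (D.o (D.o p q) r) s t ◁ (D.π p q r (D.o s t)).hom ⊗≫
      𝟙 (D.A (D.o (D.o p q) r) s t ≫ D.A (D.o p q) r (D.o s t) ≫ D.A p q (D.o r (D.o s t)))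

/-- The left normalization axiom. -/
def LeftNormal : Prop :=
  ∀ {a b c d : Obj} (h : Hom c d) (g : Hom b c) (f : Hom a b),
    𝟙 (D.m (D.m (D.r' h) (𝟙 g)) (𝟙 f) ≫ D.m (D.A h (D.I c) g) (𝟙 f) ≫
        D.A h (D.o (D.I c) g) f ≫ D.m (𝟙 h) (D.A (D.I c) g f) ≫
        D.m (𝟙 h) (D.l (D.o g f))) ⊗≫
      D.m (D.m (D.r' h) (𝟙 g)) (𝟙 f) ◁ (D.π h (D.I c) g f).hom ▷ D.m (𝟙 h) (D.l (D.o g f)) ⊗≫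
      (D.natA₁ (D.r' h) g f).hom ▷
        (D.A h (D.I c) (D.o g f) ≫ D.m (𝟙 h) (D.l (D.o g f))) ⊗≫
      D.A h g f ◁ (D.μ h (D.o g f)).hom ⊗≫
      𝟙 (D.A h g f) =
    𝟙 (D.m (D.m (D.r' h) (𝟙 g)) (𝟙 f) ≫ D.m (D.A h (D.I c) g) (𝟙 f) ≫
        D.A h (D.o (D.I c) g) f ≫ D.m (𝟙 h) (D.A (D.I c) g f) ≫
        D.m (𝟙 h) (D.l (D.o g f))) ⊗≫
      (D.m (D.m (D.r' h) (𝟙 g)) (𝟙 f) ≫ D.m (D.A h (D.I c) g) (𝟙 f) ≫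
        D.A h (D.o (D.I c) g) f) ◁ (D.lamL h g f).inv ⊗≫
      (D.m (D.m (D.r' h) (𝟙 g)) (𝟙 f) ≫ D.m (D.A h (D.I c) g) (𝟙 f)) ◁
        (D.natA₂ h (D.l g) f).inv ⊗≫
      (D.μR h g f).hom ▷ D.A h g f ⊗≫
      𝟙 (D.A h g f)

/-- The right normalization axiom. -/
def RightNormal : Prop :=
  ∀ {a b c d : Obj} (h : Hom c d) (g : Hom b c) (f : Hom a b),
    𝟙 (D.m (D.r' (D.o h g)) (𝟙 f) ≫ D.m (D.A h g (D.I b)) (𝟙 f) ≫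
        D.A h (D.o g (D.I b)) f ≫ D.m (𝟙 h) (D.A g (D.I b) f) ≫
        D.m (𝟙 h) (D.m (𝟙 g) (D.l f))) ⊗≫
      D.m (D.r' (D.o h g)) (𝟙 f) ◁ (D.π h g (D.I b) f).hom ▷
        D.m (𝟙 h) (D.m (𝟙 g) (D.l f)) ⊗≫
      (D.m (D.r' (D.o h g)) (𝟙 f) ≫ D.A (D.o h g) (D.I b) f) ◁ (D.natA₃ h g (D.l f)).inv ⊗≫
      (D.μ (D.o h g) f).hom ▷ D.A h g f ⊗≫
      𝟙 (D.A h g f) =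
    𝟙 (D.m (D.r' (D.o h g)) (𝟙 f) ≫ D.m (D.A h g (D.I b)) (𝟙 f) ≫
        D.A h (D.o g (D.I b)) f ≫ D.m (𝟙 h) (D.A g (D.I b) f) ≫
        D.m (𝟙 h) (D.m (𝟙 g) (D.l f))) ⊗≫
      (D.rhoR h g f).inv ▷ (D.A h (D.o g (D.I b)) f ≫ D.m (𝟙 h) (D.A g (D.I b) f) ≫
        D.m (𝟙 h) (D.m (𝟙 g) (D.l f))) ⊗≫
      (D.natA₂ h (D.r' g) f).hom ▷ (D.m (𝟙 h) (D.A g (D.I b) f) ≫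
        D.m (𝟙 h) (D.m (𝟙 g) (D.l f))) ⊗≫
      D.A h g f ◁ (D.μL h g f).hom ⊗≫
      𝟙 (D.A h g f)

end TriModData

/-- Tricategories in the sense of Gordon, Power and Street, with the adjoint equivalences as part of
the structure, on a set `Obj` of 0-cells and hom-bicategories `Hom a b`. -/
structure Tricategory (Obj : Type u) (Hom : Obj → Obj → Type u)
    [∀ a b, Bicategory.{u, u} (Hom a b)] extends TriModData Obj Hom where
  pi_natural : toTriModData.PiNatural
  mu_natural : toTriModData.MuNatural
  lam_natural : toTriModData.LamNatural
  rho_natural : toTriModData.RhoNatural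
  cocycle : toTriModData.Cocycle
  left_normal : toTriModData.LeftNormal
  right_normal : toTriModData.RightNormal

section Gray

variable {A B C : Type u} [Bicategory.{u, u} A] [Bicategory.{u, u} B] [Bicategory.{u, u} C]

/-- An adjoint equivalence that is the identity. -/
def IsIdEquiv {x y : A} (e : Bicategory.Equivalence x y) : Prop :=
  ∃ h : x = y, e = h ▸ Bicategory.Equivalence.id x

/-- An isomorphism of 1-cells that is the identity. -/
def IsIdIso {x y : A} {f g : x ⟶ y} (e : f ≅ g) : Prop := ∃ h : f = g, e = eqToIso h

/-- Cubical pseudofunctors of two variables: strict on identities, and the comparison of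
`F (f, f') ≫ F (g, g')` with `F (f ≫ g, f' ≫ g')` is the identity if `f'` or `g` is. -/
structure IsCubical (F : (A × B) ⥤ᵖ C) : Prop where
  mapId : ∀ x : A × B, IsIdIso (F.mapId x)
  mapComp_left : ∀ {x y : A} {x' : B} {z : A × B} (f : x ⟶ y) (g : (y, x') ⟶ z),
    IsIdIso (F.mapComp (f ×ₘ 𝟙 x') g)
  mapComp_right : ∀ {x : A × B} {y : A} {y' z' : B} (f : x ⟶ (y, y')) (g : y' ⟶ z'),
    IsIdIso (F.mapComp f (𝟙 y ×ₘ g))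

end Gray

namespace Tricategory

variable {Obj : Type u} {Hom : Obj → Obj → Type u} [∀ a b, Bicategory.{u, u} (Hom a b)]

/-- Gray-categories: tricategories in which everything is strict except interchange, that is, the
hom-bicategories are 2-categories, composition is cubical, and the units and all the constraints are
identities. -/
structure IsGray (T : Tricategory Obj Hom) : Prop where
  strict : ∀ a b, Bicategory.Strict (Hom a b)
  comp : ∀ a b c, IsCubical (T.comp a b c)
  unit : ∀ a x, IsIdIso ((T.unit a).mapId x)
  assoc : ∀ a b c d, IsIdEquiv (T.assoc a b c d)
  left : ∀ a b, IsIdEquiv (T.left a b)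
  right : ∀ a b, IsIdEquiv (T.right a b)
  pi : ∀ {a b c d e : Obj} (k : Hom d e) (h : Hom c d) (g : Hom b c) (f : Hom a b),
    IsIdIso (T.π k h g f)
  mu : ∀ {a b c : Obj} (g : Hom b c) (f : Hom a b), IsIdIso (T.μ g f)
  lam : ∀ {a b c : Obj} (g : Hom b c) (f : Hom a b), IsIdIso (T.lam g f)
  rho : ∀ {a b c : Obj} (g : Hom b c) (f : Hom a b), IsIdIso (T.rho g f)

end Tricategory

namespace Tricategory

variable {Obj : Type u} {Hom : Obj → Obj → Type u} [∀ a b, Bicategory.{u, u} (Hom a b)]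

variable (Hom) in
/-- The `m`-cells of a tricategory. -/
def Cells : ℕ → Type u
  | 0 => Obj
  | 1 => Σ a b : Obj, Hom a b
  | 2 => Σ (a b : Obj) (f g : Hom a b), f ⟶ g
  | 3 => Σ (a b : Obj) (f g : Hom a b) (α β : f ⟶ g), α ⟶ β
  | _ + 4 => PEmpty

/-- A 2-cell as an element of the set of 2-cells. -/
def cell₂ {a b : Obj} {f g : Hom a b} (α : f ⟶ g) : Cells Hom 2 := ⟨a, b, f, g, α⟩

/-- A 3-cell as an element of the set of 3-cells. -/
def cell₃ {a b : Obj} {f g : Hom a b} {α β : f ⟶ g} (Φ : α ⟶ β) : Cells Hom 3 :=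
  ⟨a, b, f, g, α, β, Φ⟩

/-- The underlying reflexive globular set of a tricategory. -/
def toRGSet (T : Tricategory Obj Hom) : Penon.RGSet.{u} 3 where
  cells := Cells Hom
  isEmpty_cells {m} h := by
    obtain ⟨k, rfl⟩ : ∃ k, m = k + 4 := ⟨m - 4, by omega⟩
    exact inferInstanceAs (IsEmpty PEmpty)
  s {m} x := match m, x with
    | 0, ⟨a, _, _⟩ => a
    | 1, ⟨a, b, f, _, _⟩ => ⟨a, b, f⟩
    | 2, ⟨_, _, _, _, α, _, _⟩ => cell₂ α
  t {m} x := match m, x with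
    | 0, ⟨_, b, _⟩ => b
    | 1, ⟨a, b, _, g, _⟩ => ⟨a, b, g⟩
    | 2, ⟨_, _, _, _, _, β, _⟩ => cell₂ β
  i {m} h x := match m, h, x with
    | 0, _, a => ⟨a, a, T.I a⟩
    | 1, _, ⟨_, _, f⟩ => cell₂ (𝟙 f)
    | 2, _, ⟨_, _, _, _, α⟩ => cell₃ (𝟙 α)
  s_s {m} x := match m, x with
    | 0, _ => rfl
    | 1, _ => rfl
  t_s {m} x := match m, x with
    | 0, _ => rfl
    | 1, _ => rfl
  s_i {m} h x := match m, h, x with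
    | 0, _, _ => rfl
    | 1, _, _ => rfl
    | 2, _, _ => rfl
  t_i {m} h x := match m, h, x with
    | 0, _, _ => rfl
    | 1, _, _ => rfl
    | 2, _, _ => rfl

/-- A presentation of the tricategory `T` as the Penon 3-category `X`: an isomorphism between the
underlying reflexive globular sets that preserves the composition of 2-cells and of 3-cells inside
the hom-bicategories, that is, the composition of 2-cells along 1-cells, of 3-cells along 2-cells
and of 3-cells along 1-cells. Compatibility of the composition along 0-cells is not required (so
that it is a stronger statement that there is no presentation). -/
structure PenonPresentation (T : Tricategory Obj Hom) (X : (Penon.monad.{u} 3).Algebra) where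
  iso : T.toRGSet ≅ X.A
  map_comp₂ : ∀ {a b : Obj} {f g h : Hom a b} (α : f ⟶ g) (β : g ⟶ h),
    iso.hom.map (m := 2) (cell₂ (α ≫ β)) =
      Penon.algComp X 1 (iso.hom.map (m := 2) (cell₂ β)) (iso.hom.map (m := 2) (cell₂ α))
        (.map iso.hom (A := T.toRGSet) (m := 2) rfl)
  map_comp₃ : ∀ {a b : Obj} {f g : Hom a b} {α β γ : f ⟶ g} (Φ : α ⟶ β) (Ψ : β ⟶ γ),
    iso.hom.map (m := 3) (cell₃ (Φ ≫ Ψ)) =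
      Penon.algComp X 2 (iso.hom.map (m := 3) (cell₃ Ψ)) (iso.hom.map (m := 3) (cell₃ Φ))
        (.map iso.hom (A := T.toRGSet) (m := 3) rfl)
  map_hcomp₃ : ∀ {a b : Obj} {f g h : Hom a b} {α α' : f ⟶ g} {β β' : g ⟶ h} (Φ : α ⟶ α')
      (Ψ : β ⟶ β'),
    iso.hom.map (m := 3) (cell₃ (Φ ▷ β ≫ α' ◁ Ψ)) =
      Penon.algComp X 1 (iso.hom.map (m := 3) (cell₃ Ψ)) (iso.hom.map (m := 3) (cell₃ Φ))
        (.map iso.hom (A := T.toRGSet) (m := 3) rfl)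

/-- The tricategory `T` is (presented by) a Penon 3-category. -/
def IsPenon (T : Tricategory Obj Hom) : Prop :=
  ∃ X : (Penon.monad.{u} 3).Algebra, Nonempty (T.PenonPresentation X)

end Tricategory

end Tri

/-!
A braided strict monoidal category determines a pseudofunctor of two variables, whose interchange
constraint is built from the braiding. It is cubical because the braiding with the unit object is an
identity, and strictly associative by the hexagon identities. All other structural cells are
identities, and so is every 3-cell that occurs in the axioms of a tricategory; two identities that
are equal up to transport of their source and target coincide.

Over a contraction that is injective on parallel 3-cells with the same image, equations between
3-cells can be checked in a strict 3-category. There the Eckmann–Hilton argument shows that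
horizontal composites of endomorphisms of an endo-2-cell of an identity 1-cell commute. Hence they
commute in every Penon 3-category, being images of composites in a free algebra. In the braid
category this would say `σ₀ ⊗ 1 = 1 ⊗ σ₀` in `B₄`, that is `σ₀ = σ₂`, but these two braids have
different underlying permutations.
-/

section Identities

open Bicategory CategoryTheory.Prod

universe w v u w' v' u'

/-- The morphisms that are identities, up to an equality between their source and their target. As a
class, so that instance search proves that a composite of structural morphisms is an identity. -/
class IsIdentity {C : Type u} [CategoryStruct.{v} C] {X Y : C} (f : X ⟶ Y) : Prop where
  exists_eq_eqToHom : ∃ h : X = Y, f = eqToHom h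

namespace IsIdentity

section CategoryStruct

variable {C : Type u} [CategoryStruct.{v} C] {X Y X' Y' : C}

instance (X : C) : IsIdentity (𝟙 X) := ⟨rfl, rfl⟩

instance {D : Type u'} [CategoryStruct.{v'} D] {U V : D} (f : X ⟶ Y) (g : U ⟶ V)
    [hf : IsIdentity f] [hg : IsIdentity g] : IsIdentity (f ×ₘ g) := by
  obtain ⟨rfl, rfl⟩ := hf
  obtain ⟨rfl, rfl⟩ := hg
  exact ⟨rfl, rfl⟩

theorem eq {f g : X ⟶ Y} [hf : IsIdentity f] [hg : IsIdentity g] : f = g := by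
  obtain ⟨_, rfl⟩ := hf
  obtain ⟨_, rfl⟩ := hg
  rfl

theorem heq {f : X ⟶ Y} {f' : X' ⟶ Y'} [hf : IsIdentity f] [hf' : IsIdentity f'] (h : X = X') :
    f ≍ f' := by
  obtain ⟨rfl, rfl⟩ := hf
  obtain ⟨rfl, rfl⟩ := hf'
  subst h
  rfl

end CategoryStruct

section Category

variable {C : Type u} [Category.{v} C] {X Y Z X' Y' : C}

instance (f : X ⟶ Y) (g : Y ⟶ Z) [hf : IsIdentity f] [hg : IsIdentity g] : IsIdentity (f ≫ g) := by
  obtain ⟨rfl, rfl⟩ := hf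
  obtain ⟨rfl, rfl⟩ := hg
  exact ⟨rfl, Category.comp_id _⟩

instance (X : C) : IsIdentity (Iso.refl X).hom := inferInstanceAs (IsIdentity (𝟙 X))

instance (e : X ≅ Y) [he : IsIdentity e.hom] : IsIdentity e.inv := by
  obtain ⟨rfl, he⟩ := he
  obtain rfl : e = Iso.refl X := Iso.ext he
  exact ⟨rfl, rfl⟩

instance (e : X ≅ Y) [IsIdentity e.hom] : IsIdentity e.symm.hom :=
  inferInstanceAs (IsIdentity e.inv)

instance (e : X ≅ Y) (e' : Y ≅ Z) [IsIdentity e.hom] [IsIdentity e'.hom] :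
    IsIdentity (e ≪≫ e').hom :=
  inferInstanceAs (IsIdentity (e.hom ≫ e'.hom))

theorem heq_of_comp_eq {f : X ⟶ Y} {f' : X' ⟶ Y'} (u : X ⟶ X') (v : Y ⟶ Y') [hu : IsIdentity u]
    [hv : IsIdentity v] (h : f ≫ v = u ≫ f') : f ≍ f' := by
  obtain ⟨rfl, rfl⟩ := hu
  obtain ⟨rfl, rfl⟩ := hv
  simpa using h

end Category

open MonoidalCategory in
instance {C : Type u} [Category.{v} C] [MonoidalCategory C] {X Y X' Y' : C} (f : X ⟶ Y)
    (g : X' ⟶ Y') [hf : IsIdentity f] [hg : IsIdentity g] : IsIdentity (f ⊗ₘ g) := by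
  obtain ⟨rfl, rfl⟩ := hf
  obtain ⟨rfl, rfl⟩ := hg
  exact ⟨rfl, id_tensorHom_id _ _⟩

section Bicategory

variable {B : Type u} [Bicategory.{w, v} B] {a b c d : B}

instance (f : a ⟶ b) {g h : b ⟶ c} (η : g ⟶ h) [hη : IsIdentity η] : IsIdentity (f ◁ η) := by
  obtain ⟨rfl, rfl⟩ := hη
  exact ⟨rfl, Bicategory.whiskerLeft_id f g⟩

instance {f g : a ⟶ b} (η : f ⟶ g) (h : b ⟶ c) [hη : IsIdentity η] : IsIdentity (η ▷ h) := by
  obtain ⟨rfl, rfl⟩ := hη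
  exact ⟨rfl, Bicategory.id_whiskerRight f h⟩

instance (f : a ⟶ b) {g h : b ⟶ c} (e : g ≅ h) [IsIdentity e.hom] :
    IsIdentity (whiskerLeftIso f e).hom :=
  inferInstanceAs (IsIdentity (f ◁ e.hom))

instance {f g : a ⟶ b} (e : f ≅ g) (h : b ⟶ c) [IsIdentity e.hom] :
    IsIdentity (whiskerRightIso e h).hom :=
  inferInstanceAs (IsIdentity (e.hom ▷ h))

instance {f g h i : a ⟶ b} (η : f ⟶ g) (θ : h ⟶ i) [BicategoricalCoherence g h] [IsIdentity η]
    [IsIdentity θ] [IsIdentity (⊗𝟙 : g ≅ h).hom] : IsIdentity (η ⊗≫ θ) :=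
  inferInstanceAs (IsIdentity (η ≫ (⊗𝟙 : g ≅ h).hom ≫ θ))

instance (f : a ⟶ b) : IsIdentity (BicategoricalCoherence.refl f).iso.hom :=
  inferInstanceAs (IsIdentity (𝟙 f))

instance (f : a ⟶ b) (g h : b ⟶ c) [BicategoricalCoherence g h] [IsIdentity (⊗𝟙 : g ≅ h).hom] :
    IsIdentity (BicategoricalCoherence.whiskerLeft f g h).iso.hom :=
  inferInstanceAs (IsIdentity (f ◁ (⊗𝟙 : g ≅ h).hom))

instance (f g : a ⟶ b) (h : b ⟶ c) [BicategoricalCoherence f g] [IsIdentity (⊗𝟙 : f ≅ g).hom] :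
    IsIdentity (BicategoricalCoherence.whiskerRight f g h).iso.hom :=
  inferInstanceAs (IsIdentity ((⊗𝟙 : f ≅ g).hom ▷ h))

section Strict

variable [Bicategory.Strict B]

instance (f : a ⟶ b) (g : b ⟶ c) (h : c ⟶ d) : IsIdentity (α_ f g h).hom :=
  ⟨Strict.assoc f g h, by rw [Strict.associator_eqToIso, eqToIso.hom]⟩

instance (f : a ⟶ b) : IsIdentity (λ_ f).hom :=
  ⟨Strict.id_comp f, by rw [Strict.leftUnitor_eqToIso, eqToIso.hom]⟩

instance (f : a ⟶ b) : IsIdentity (ρ_ f).hom :=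
  ⟨Strict.comp_id f, by rw [Strict.rightUnitor_eqToIso, eqToIso.hom]⟩

instance (f g : a ⟶ b) [BicategoricalCoherence f g] [IsIdentity (⊗𝟙 : f ≅ g).hom] :
    IsIdentity (BicategoricalCoherence.left f g).iso.hom :=
  inferInstanceAs (IsIdentity ((λ_ f).hom ≫ (⊗𝟙 : f ≅ g).hom))

instance (f g : a ⟶ b) [BicategoricalCoherence f g] [IsIdentity (⊗𝟙 : f ≅ g).hom] :
    IsIdentity (BicategoricalCoherence.right f g).iso.hom :=
  inferInstanceAs (IsIdentity ((ρ_ f).hom ≫ (⊗𝟙 : f ≅ g).hom))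

instance (f : a ⟶ b) (g : b ⟶ c) (h : c ⟶ d) (i : a ⟶ d) [BicategoricalCoherence (f ≫ g ≫ h) i]
    [IsIdentity (⊗𝟙 : f ≫ g ≫ h ≅ i).hom] :
    IsIdentity (BicategoricalCoherence.assoc f g h i).iso.hom :=
  inferInstanceAs (IsIdentity ((α_ f g h).hom ≫ (⊗𝟙 : f ≫ g ≫ h ≅ i).hom))

instance (f : a ⟶ b) (g : b ⟶ c) (h : c ⟶ d) (i : a ⟶ d) [BicategoricalCoherence i (f ≫ g ≫ h)]
    [IsIdentity (⊗𝟙 : i ≅ f ≫ g ≫ h).hom] :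
    IsIdentity (BicategoricalCoherence.assoc' f g h i).iso.hom :=
  inferInstanceAs (IsIdentity ((⊗𝟙 : i ≅ f ≫ g ≫ h).hom ≫ (α_ f g h).inv))

end Strict

variable {B' : Type u'} [Bicategory.{w', v'} B'] {a' b' : B'}

instance {f g : a ⟶ b} {f' g' : a' ⟶ b'} (η : f ⟶ g) (η' : f' ⟶ g') [IsIdentity η]
    [IsIdentity η'] : IsIdentity (show f ×ₘ f' ⟶ g ×ₘ g' from η ×ₘ η') :=
  inferInstanceAs (IsIdentity (X := (f, f')) (Y := (g, g')) (η ×ₘ η'))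

instance {f g : a ⟶ b} {f' g' : a' ⟶ b'} (e : f ≅ g) (e' : f' ≅ g') [IsIdentity e.hom]
    [IsIdentity e'.hom] : IsIdentity (show f ×ₘ f' ≅ g ×ₘ g' from Iso.prod e e').hom :=
  inferInstanceAs (IsIdentity (show f ×ₘ f' ⟶ g ×ₘ g' from e.hom ×ₘ e'.hom))

instance (F : B ⥤ᵖ B') {f g : a ⟶ b} (η : f ⟶ g) [hη : IsIdentity η] : IsIdentity (F.map₂ η) := by
  obtain ⟨rfl, rfl⟩ := hη
  exact ⟨rfl, F.map₂_id f⟩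

instance (F : B ⥤ᵖ B') {f g : a ⟶ b} (e : f ≅ g) [IsIdentity e.hom] :
    IsIdentity (F.map₂Iso e).hom :=
  inferInstanceAs (IsIdentity (F.map₂ e.hom))

end Bicategory

end IsIdentity

theorem isIdIso_iff_isIdentity {C : Type u} [Bicategory.{u, u} C] {x y : C} {f g : x ⟶ y}
    {e : f ≅ g} : IsIdIso e ↔ IsIdentity e.hom :=
  ⟨fun ⟨h, he⟩ => ⟨h, by rw [he, eqToIso.hom]⟩, fun ⟨h, he⟩ => ⟨h, Iso.ext he⟩⟩

end Identities

section Squares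

open Bicategory CategoryTheory.Prod

universe u

variable {A B C : Type u} [Bicategory.{u, u} A] [Bicategory.{u, u} B] [Bicategory.{u, u} C]

namespace IsIdentity

variable [Bicategory.Strict A]

instance {x₀ x₁ x₂ y₀ y₁ y₂ : A} {f : x₀ ⟶ y₀} {f' : x₁ ⟶ y₁} {f'' : x₂ ⟶ y₂} {x : x₀ ⟶ x₁}
    {x' : x₁ ⟶ x₂} {y : y₀ ⟶ y₁} {y' : y₁ ⟶ y₂} (S : f ≫ y ≅ x ≫ f') (T : f' ≫ y' ≅ x' ≫ f'')
    [IsIdentity S.hom] [IsIdentity T.hom] : IsIdentity (paste S T).hom := by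
  unfold paste
  infer_instance

instance {x y : A} (f : x ⟶ y) : IsIdentity (idSq f).hom := by
  unfold idSq
  infer_instance

end IsIdentity

instance IsIdentity.mapComp₃ (F : A ⥤ᵖ B) {x y z w : A} (f : x ⟶ y) (g : y ⟶ z) (h : z ⟶ w)
    [IsIdentity (F.mapComp f (g ≫ h)).hom] [IsIdentity (F.mapComp g h).hom] :
    IsIdentity (mapComp₃ F f g h).hom :=
  inferInstanceAs (IsIdentity ((F.mapComp f (g ≫ h)).hom ≫ F.map f ◁ (F.mapComp g h).hom))

namespace IsCubical

variable {F : (A × B) ⥤ᵖ C} {x y z : A} {x' y' z' : B}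

theorem isIdentity_mapComp_of_snd (hF : IsCubical F) (f : x ⟶ y) (g : y ⟶ z) (f' : x' ⟶ y')
    (g' : y' ⟶ z') [hf' : IsIdentity f'] :
    IsIdentity (F.mapComp (f ×ₘ f') (g ×ₘ g')).hom := by
  obtain ⟨rfl, rfl⟩ := hf'
  exact isIdIso_iff_isIdentity.1 (hF.mapComp_left f (g ×ₘ g'))

theorem isIdentity_mapComp_of_fst (hF : IsCubical F) (f : x ⟶ y) (g : y ⟶ z) (f' : x' ⟶ y')
    (g' : y' ⟶ z') [hg : IsIdentity g] :
    IsIdentity (F.mapComp (f ×ₘ f') (g ×ₘ g')).hom := by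
  obtain ⟨rfl, rfl⟩ := hg
  exact isIdIso_iff_isIdentity.1 (hF.mapComp_right (f ×ₘ f') g')

end IsCubical

end Squares

section Gray

open Bicategory CategoryTheory.Prod

open scoped Pseudofunctor.StrongTrans

universe u

section IdentityEquivalences

variable {A B : Type u} [Bicategory.{u, u} A] [Bicategory.{u, u} B] {F G : A ⥤ᵖ B}

/-- The identity equivalence between two equal pseudofunctors. -/
def equivOfEq (h : F = G) : Bicategory.Equivalence F G := h ▸ Bicategory.Equivalence.id F

theorem isIdEquiv_equivOfEq (h : F = G) : IsIdEquiv (equivOfEq h) := ⟨h, rfl⟩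

namespace IsIdEquiv

variable {e : Bicategory.Equivalence F G}

theorem isIdentity_hom_app (he : IsIdEquiv e) (x : A) : IsIdentity (e.hom.app x) := by
  obtain ⟨rfl, rfl⟩ := he
  exact ⟨rfl, rfl⟩

theorem isIdentity_inv_app (he : IsIdEquiv e) (x : A) : IsIdentity (e.inv.app x) := by
  obtain ⟨rfl, rfl⟩ := he
  exact ⟨rfl, rfl⟩

variable [Bicategory.Strict B]

theorem isIdentity_hom_naturality (he : IsIdEquiv e) {x y : A} (f : x ⟶ y) :
    IsIdentity (e.hom.naturality f).hom := by
  obtain ⟨rfl, rfl⟩ := he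
  exact inferInstanceAs (IsIdentity ((ρ_ _).hom ≫ (λ_ _).inv))

theorem isIdentity_inv_naturality (he : IsIdEquiv e) {x y : A} (f : x ⟶ y) :
    IsIdentity (e.inv.naturality f).hom := by
  obtain ⟨rfl, rfl⟩ := he
  exact inferInstanceAs (IsIdentity ((ρ_ _).hom ≫ (λ_ _).inv))

end IsIdEquiv

end IdentityEquivalences

variable {Obj : Type u} {Hom : Obj → Obj → Type u} [∀ a b, Bicategory.{u, u} (Hom a b)]

/-- The composition functors and constraint equivalences of a Gray-category: composition is cubical
and everything else is an identity. -/
class TriData.IsGray (D : TriData Obj Hom) : Prop where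
  comp : ∀ a b c, IsCubical (D.comp a b c)
  unit : ∀ a x, IsIdIso ((D.unit a).mapId x)
  assoc : ∀ a b c d, IsIdEquiv (D.assoc a b c d)
  left : ∀ a b, IsIdEquiv (D.left a b)
  right : ∀ a b, IsIdEquiv (D.right a b)

namespace TriData

variable (D : TriData Obj Hom) [D.IsGray] {a b c d : Obj}

instance (x) : IsIdentity ((D.comp a b c).mapId x).hom :=
  isIdIso_iff_isIdentity.1 ((IsGray.comp a b c).mapId x)

instance (h : Hom c d) (g : Hom b c) (f : Hom a b) : IsIdentity (D.A h g f) :=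
  (IsGray.assoc a b c d).isIdentity_hom_app _

instance (f : Hom a b) : IsIdentity (D.l f) := (IsGray.left a b).isIdentity_hom_app _

instance (f : Hom a b) : IsIdentity (D.r' f) := (IsGray.right a b).isIdentity_inv_app _

variable {g g' g'' : Hom b c} {f f' f'' : Hom a b}

instance (γ : g ⟶ g') (φ : f ⟶ f') [hγ : IsIdentity γ] [hφ : IsIdentity φ] :
    IsIdentity (D.m γ φ) := by
  obtain ⟨rfl, rfl⟩ := hγ
  obtain ⟨rfl, rfl⟩ := hφ
  obtain ⟨h, _⟩ := (IsGray.comp (D := D) a b c).mapId (g, f)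
  exact ⟨rfl, h⟩

instance (γ : g ⟶ g') (γ' : g' ⟶ g'') (φ : f ⟶ f') (φ' : f' ⟶ f'') [IsIdentity φ] :
    IsIdentity ((D.comp a b c).mapComp (γ ×ₘ φ) (γ' ×ₘ φ')).hom :=
  (IsGray.comp a b c).isIdentity_mapComp_of_snd _ _ _ _

instance (γ : g ⟶ g') (γ' : g' ⟶ g'') (φ : f ⟶ f') (φ' : f' ⟶ f'') [IsIdentity γ'] :
    IsIdentity ((D.comp a b c).mapComp (γ ×ₘ φ) (γ' ×ₘ φ')).hom :=
  (IsGray.comp a b c).isIdentity_mapComp_of_fst _ _ _ _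

instance (c : Obj) (f : Hom a b) (g : Hom b c) : IsIdentity ((D.R c f).mapId g).hom :=
  inferInstanceAs (IsIdentity ((D.comp a b c).map₂ (𝟙 _) ≫ ((D.comp a b c).mapId (g, f)).hom))

instance (a : Obj) (g : Hom b c) (f : Hom a b) : IsIdentity ((D.L a g).mapId f).hom :=
  inferInstanceAs (IsIdentity ((D.comp a b c).map₂ (𝟙 _) ≫ ((D.comp a b c).mapId (g, f)).hom))

instance {h h' k k' : Hom b c} {h₁ h₁' k₁ k₁' : Hom a b} {f : h ⟶ k} {f' : h' ⟶ k'} {p : h ⟶ h'}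
    {q : k ⟶ k'} {g : h₁ ⟶ k₁} {g' : h₁' ⟶ k₁'} {r : h₁ ⟶ h₁'} {s : k₁ ⟶ k₁'} (S : f ≫ q ≅ p ≫ f')
    (T : g ≫ s ≅ r ≫ g') [IsIdentity q] [IsIdentity r] [IsIdentity S.hom] [IsIdentity T.hom] :
    IsIdentity (mapSq (D.comp a b c) S T).hom := by
  unfold mapSq
  infer_instance

variable [∀ a b, Bicategory.Strict (Hom a b)]

instance (f : Hom a b) (γ : g ⟶ g') (γ' : g' ⟶ g'') : IsIdentity ((D.R c f).mapComp γ γ').hom :=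
  inferInstanceAs (IsIdentity
    ((D.comp a b c).map₂Iso (Iso.prod (Iso.refl (γ ≫ γ')) (λ_ (𝟙 f)).symm) ≪≫
      (D.comp a b c).mapComp (γ ×ₘ 𝟙 f) (γ' ×ₘ 𝟙 f)).hom)

instance (g : Hom b c) (φ : f ⟶ f') (φ' : f' ⟶ f'') : IsIdentity ((D.L a g).mapComp φ φ').hom :=
  inferInstanceAs (IsIdentity
    ((D.comp a b c).map₂Iso (Iso.prod (ρ_ (𝟙 g)).symm (Iso.refl (φ ≫ φ'))) ≪≫
      (D.comp a b c).mapComp (𝟙 g ×ₘ φ) (𝟙 g ×ₘ φ')).hom)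

instance {h h' : Hom c d} (χ : h ⟶ h') (γ : g ⟶ g') (φ : f ⟶ f') :
    IsIdentity (D.natA χ γ φ).hom :=
  (IsGray.assoc a b c d).isIdentity_hom_naturality _

instance (φ : f ⟶ f') : IsIdentity (D.natL φ).hom :=
  (IsGray.left a b).isIdentity_hom_naturality _

instance (φ : f ⟶ f') : IsIdentity (D.natR' φ).hom :=
  (IsGray.right a b).isIdentity_inv_naturality _

instance {h h' : Hom c d} (χ : h ⟶ h') (g : Hom b c) (f : Hom a b) :
    IsIdentity (D.natA₁ χ g f).hom := by
  unfold natA₁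
  infer_instance

instance (h : Hom c d) (γ : g ⟶ g') (f : Hom a b) : IsIdentity (D.natA₂ h γ f).hom := by
  unfold natA₂
  infer_instance

instance (h : Hom c d) (g : Hom b c) (φ : f ⟶ f') : IsIdentity (D.natA₃ h g φ).hom := by
  unfold natA₃
  infer_instance

end TriData

/-- The data of a Gray-category: moreover the constraint modifications are identities. -/
class TriModData.IsGray (D : TriModData Obj Hom) : Prop extends D.toTriData.IsGray where
  pi : ∀ {a b c d e : Obj} (k : Hom d e) (h : Hom c d) (g : Hom b c) (f : Hom a b),
    IsIdIso (D.π k h g f)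
  mu : ∀ {a b c : Obj} (g : Hom b c) (f : Hom a b), IsIdIso (D.μ g f)
  lam : ∀ {a b c : Obj} (g : Hom b c) (f : Hom a b), IsIdIso (D.lam g f)
  rho : ∀ {a b c : Obj} (g : Hom b c) (f : Hom a b), IsIdIso (D.rho g f)

namespace TriModData

section Axioms

variable (D : TriModData Obj Hom) [D.IsGray] {a b c d e z : Obj}

instance (k : Hom d e) (h : Hom c d) (g : Hom b c) (f : Hom a b) : IsIdentity (D.π k h g f).hom :=
  isIdIso_iff_isIdentity.1 (IsGray.pi k h g f)

instance (g : Hom b c) (f : Hom a b) : IsIdentity (D.μ g f).hom :=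
  isIdIso_iff_isIdentity.1 (IsGray.mu g f)

instance (g : Hom b c) (f : Hom a b) : IsIdentity (D.lam g f).hom :=
  isIdIso_iff_isIdentity.1 (IsGray.lam g f)

instance (g : Hom b c) (f : Hom a b) : IsIdentity (D.rho g f).hom :=
  isIdIso_iff_isIdentity.1 (IsGray.rho g f)

variable [∀ a b, Bicategory.Strict (Hom a b)]

variable (p : Hom d e) (q : Hom c d) (r : Hom b c) (s : Hom a b) (t : Hom z a)

instance : IsIdentity (D.πR p q r s t).hom :=
  inferInstanceAs (IsIdentity ((mapComp₃ (D.R e t) _ _ _).symm ≪≫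
    (D.R e t).map₂Iso (D.π p q r s) ≪≫ (D.R e t).mapComp _ _).hom)

instance : IsIdentity (D.πL p q r s t).hom :=
  inferInstanceAs (IsIdentity ((mapComp₃ (D.L z p) _ _ _).symm ≪≫
    (D.L z p).map₂Iso (D.π q r s t) ≪≫ (D.L z p).mapComp _ _).hom)

instance : IsIdentity (D.μR p q r).hom :=
  inferInstanceAs (IsIdentity ((mapComp₃ (D.R e r) _ _ _).symm ≪≫
    (D.R e r).map₂Iso (D.μ p q) ≪≫ (D.R e r).mapId _).hom)

instance : IsIdentity (D.μL p q r).hom :=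
  inferInstanceAs (IsIdentity ((mapComp₃ (D.L b p) _ _ _).symm ≪≫
    (D.L b p).map₂Iso (D.μ q r) ≪≫ (D.L b p).mapId _).hom)

instance : IsIdentity (D.lamL p q r).hom :=
  inferInstanceAs (IsIdentity ((D.L b p).map₂Iso (D.lam q r) ≪≫ (D.L b p).mapComp _ _).hom)

instance : IsIdentity (D.rhoR p q r).hom :=
  inferInstanceAs (IsIdentity ((D.R e r).map₂Iso (D.rho p q) ≪≫ (D.R e r).mapComp _ _).hom)

theorem piNatural : D.PiNatural := fun _ _ _ _ => IsIdentity.eq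

theorem muNatural : D.MuNatural := fun _ _ => IsIdentity.eq

theorem lamNatural : D.LamNatural := fun _ _ => IsIdentity.eq

theorem rhoNatural : D.RhoNatural := fun _ _ => IsIdentity.eq

theorem cocycle : D.Cocycle := fun _ _ _ _ _ => IsIdentity.eq

theorem leftNormal : D.LeftNormal := fun _ _ _ => IsIdentity.eq

theorem rightNormal : D.RightNormal := fun _ _ _ => IsIdentity.eq

end Axioms

end TriModData

/-- The modifications of a Gray-category: since both sides are identities, so are they. -/
def TriData.toTriModData (D : TriData Obj Hom) [D.IsGray] [∀ a b, Bicategory.Strict (Hom a b)] :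
    TriModData Obj Hom where
  toTriData := D
  π _ _ _ _ := eqToIso IsIdentity.eq
  μ _ _ := eqToIso IsIdentity.eq
  lam _ _ := eqToIso IsIdentity.eq
  rho _ _ := eqToIso IsIdentity.eq

instance (D : TriData Obj Hom) [hD : D.IsGray] [∀ a b, Bicategory.Strict (Hom a b)] :
    D.toTriModData.IsGray where
  __ := hD
  pi _ _ _ _ := ⟨_, rfl⟩
  mu _ _ := ⟨_, rfl⟩
  lam _ _ := ⟨_, rfl⟩
  rho _ _ := ⟨_, rfl⟩

/-- The axioms of a tricategory equate composites of identities. -/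
def TriModData.toTricategory (D : TriModData Obj Hom) [D.IsGray]
    [∀ a b, Bicategory.Strict (Hom a b)] : Tricategory Obj Hom where
  toTriModData := D
  pi_natural := D.piNatural
  mu_natural := D.muNatural
  lam_natural := D.lamNatural
  rho_natural := D.rhoNatural
  cocycle := D.cocycle
  left_normal := D.leftNormal
  right_normal := D.rightNormal

theorem TriModData.isGray_toTricategory (D : TriModData Obj Hom) [hD : D.IsGray]
    [hHom : ∀ a b, Bicategory.Strict (Hom a b)] : D.toTricategory.IsGray :=
  { hD with strict := hHom }

end Gray

section Extensionality

open Bicategory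

universe w v u w' v' u'

variable {B : Type u} [Bicategory.{w, v} B] {B' : Type u'} [Bicategory.{w', v'} B'] {F G : B ⥤ᵖ B'}

theorem pseudofunctor_hext [hF : ∀ x, IsIdentity (F.mapId x).hom]
    [hG : ∀ x, IsIdentity (G.mapId x).hom] (obj : ∀ x : B, F.obj x = G.obj x)
    (map : ∀ {x y : B} (f : x ⟶ y), F.map f ≍ G.map f)
    (map₂ : ∀ {x y : B} {f g : x ⟶ y} (η : f ⟶ g), F.map₂ η ≍ G.map₂ η)
    (mapComp : ∀ {x y z : B} (f : x ⟶ y) (g : y ⟶ z), (F.mapComp f g).hom ≍ (G.mapComp f g).hom) :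
    F = G := by
  obtain ⟨⟨⟨⟨Fo, Fm⟩, Fm₂⟩, _, _⟩, Fi, Fc, _, _, _, _, _⟩ := F
  obtain ⟨⟨⟨⟨Go, Gm⟩, Gm₂⟩, _, _⟩, Gi, Gc, _, _, _, _, _⟩ := G
  dsimp only at hF hG obj map map₂ mapComp
  obtain rfl : Fo = Go := funext obj
  obtain rfl : @Fm = @Gm := by
    funext x y f
    exact eq_of_heq (map f)
  obtain rfl : @Fm₂ = @Gm₂ := by
    funext x y f g η
    exact eq_of_heq (map₂ η)
  obtain rfl : Fi = Gi := by
    funext x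
    exact Iso.ext IsIdentity.eq
  obtain rfl : @Fc = @Gc := by
    funext x y z f g
    exact Iso.ext (eq_of_heq (mapComp f g))
  rfl

end Extensionality

section Pseudofunctors

open Bicategory CategoryTheory.Prod

universe u

variable {A B C D : Type u} [Bicategory.{u, u} A] [Bicategory.{u, u} B] [Bicategory.{u, u} C]
  [Bicategory.{u, u} D]

namespace IsIdentity

instance (x : A) : IsIdentity ((Pseudofunctor.id A).mapId x).hom :=
  inferInstanceAs (IsIdentity (𝟙 (𝟙 x)))

instance {x y z : A} (f : x ⟶ y) (g : y ⟶ z) : IsIdentity ((Pseudofunctor.id A).mapComp f g).hom :=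
  inferInstanceAs (IsIdentity (𝟙 (f ≫ g)))

instance (F : A ⥤ᵖ B) (G : B ⥤ᵖ C) (x : A) [IsIdentity (F.mapId x).hom]
    [IsIdentity (G.mapId (F.obj x)).hom] : IsIdentity ((F.comp G).mapId x).hom :=
  inferInstanceAs (IsIdentity (G.map₂Iso (F.mapId x) ≪≫ G.mapId (F.obj x)).hom)

instance (F : A ⥤ᵖ B) (G : B ⥤ᵖ C) {x y z : A} (f : x ⟶ y) (g : y ⟶ z)
    [IsIdentity (F.mapComp f g).hom] [IsIdentity (G.mapComp (F.map f) (F.map g)).hom] :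
    IsIdentity ((F.comp G).mapComp f g).hom :=
  inferInstanceAs (IsIdentity (G.map₂Iso (F.mapComp f g) ≪≫ G.mapComp (F.map f) (F.map g)).hom)

instance (F : A ⥤ᵖ B) (G : C ⥤ᵖ D) (x : A × C) [IsIdentity (F.mapId x.1).hom]
    [IsIdentity (G.mapId x.2).hom] : IsIdentity ((prodMap F G).mapId x).hom :=
  inferInstanceAs (IsIdentity (show F.map (𝟙 x.1) ×ₘ G.map (𝟙 x.2) ≅ 𝟙 _ ×ₘ 𝟙 _ from
    Iso.prod (F.mapId x.1) (G.mapId x.2)).hom)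

instance (F : A ⥤ᵖ B) (G : C ⥤ᵖ D) {x y z : A × C} (f : x ⟶ y) (g : y ⟶ z)
    [IsIdentity (F.mapComp f.1 g.1).hom] [IsIdentity (G.mapComp f.2 g.2).hom] :
    IsIdentity ((prodMap F G).mapComp f g).hom :=
  inferInstanceAs (IsIdentity (show F.map (f.1 ≫ g.1) ×ₘ G.map (f.2 ≫ g.2) ≅
    (F.map f.1 ≫ F.map g.1) ×ₘ (G.map f.2 ≫ G.map g.2) from
    Iso.prod (F.mapComp f.1 g.1) (G.mapComp f.2 g.2)).hom)

instance (x : (A × B) × C) : IsIdentity ((prodAssoc A B C).mapId x).hom :=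
  inferInstanceAs (IsIdentity (𝟙 _))

instance (a : A) (x : B) : IsIdentity ((Bicategory.Prod.sectR a B).mapId x).hom :=
  inferInstanceAs (IsIdentity (𝟙 _))

instance (a : A) (x : B) : IsIdentity ((Bicategory.Prod.sectL B a).mapId x).hom :=
  inferInstanceAs (IsIdentity (𝟙 _))

variable [Bicategory.Strict A]

instance (a : A) {x y z : B} (f : x ⟶ y) (g : y ⟶ z) :
    IsIdentity ((Bicategory.Prod.sectR a B).mapComp f g).hom :=
  inferInstanceAs (IsIdentity (show 𝟙 a ×ₘ (f ≫ g) ≅ (𝟙 a ≫ 𝟙 a) ×ₘ (f ≫ g) from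
    Iso.prod (ρ_ (𝟙 a)).symm (Iso.refl _)).hom)

instance (a : A) {x y z : B} (f : x ⟶ y) (g : y ⟶ z) :
    IsIdentity ((Bicategory.Prod.sectL B a).mapComp f g).hom :=
  inferInstanceAs (IsIdentity (show (f ≫ g) ×ₘ 𝟙 a ≅ (f ≫ g) ×ₘ (𝟙 a ≫ 𝟙 a) from
    Iso.prod (Iso.refl _) (λ_ (𝟙 a)).symm).hom)

end IsIdentity

end Pseudofunctors

section Interchange

open MonoidalCategory

universe v u

variable {C : Type u} [Category.{v} C] [MonoidalCategory C]

namespace IsIdentity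

instance {X Y : C} (f : X ⟶ Y) (Z : C) [hf : IsIdentity f] : IsIdentity (f ▷ Z) := by
  rw [← tensorHom_id]
  infer_instance

instance (Z : C) {X Y : C} (f : X ⟶ Y) [hf : IsIdentity f] : IsIdentity (Z ◁ f) := by
  rw [← id_tensorHom]
  infer_instance

variable [Bicategory.Strict (MonoidalSingleObj C)]

instance (X Y Z : C) : IsIdentity (α_ X Y Z).hom :=
  inferInstanceAs (IsIdentity
    (Bicategory.associator (B := MonoidalSingleObj C) (a := .star C) (b := .star C) (c := .star C)
      (d := .star C) X Y Z).hom)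

instance (X : C) : IsIdentity (λ_ X).hom :=
  let f : MonoidalSingleObj.star C ⟶ .star C := X
  inferInstanceAs (IsIdentity (Bicategory.leftUnitor f).hom)

instance (X : C) : IsIdentity (ρ_ X).hom :=
  let f : MonoidalSingleObj.star C ⟶ .star C := X
  inferInstanceAs (IsIdentity (Bicategory.rightUnitor f).hom)

variable [BraidedCategory C]

instance (X : C) : IsIdentity (β_ (𝟙_ C) X).hom := by
  rw [braiding_tensorUnit_left]
  infer_instance

instance (X : C) : IsIdentity (β_ X (𝟙_ C)).hom := by
  rw [braiding_tensorUnit_right]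
  infer_instance

instance (X₁ X₂ Y₁ Y₂ : C) [IsIdentity (β_ X₂ Y₁).hom] : IsIdentity (tensorδ X₁ X₂ Y₁ Y₂) := by
  unfold tensorδ
  infer_instance

end IsIdentity

variable [BraidedCategory C]

theorem tensorδ_assoc (X₁ X₂ X₃ Y₁ Y₂ Y₃ : C) :
    (tensorδ X₁ X₂ Y₁ Y₂ ▷ (X₃ ⊗ Y₃) ≫ tensorδ (X₁ ⊗ X₂) X₃ (Y₁ ⊗ Y₂) Y₃) ≫
        ((α_ X₁ X₂ X₃).hom ⊗ₘ (α_ Y₁ Y₂ Y₃).hom) =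
      (α_ (X₁ ⊗ Y₁) (X₂ ⊗ Y₂) (X₃ ⊗ Y₃)).hom ≫
        (X₁ ⊗ Y₁) ◁ tensorδ X₂ X₃ Y₂ Y₃ ≫ tensorδ X₁ (X₂ ⊗ X₃) Y₁ (Y₂ ⊗ Y₃) := by
  have h₁ : (tensorδ X₁ X₂ Y₁ Y₂ ▷ (X₃ ⊗ Y₃) ≫ tensorδ (X₁ ⊗ X₂) X₃ (Y₁ ⊗ Y₂) Y₃) ≫
      tensorμ (X₁ ⊗ X₂) X₃ (Y₁ ⊗ Y₂) Y₃ ≫ tensorμ X₁ X₂ Y₁ Y₂ ▷ (X₃ ⊗ Y₃) = 𝟙 _ := by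
    rw [Category.assoc, tensorδ_tensorμ_assoc, ← comp_whiskerRight, tensorδ_tensorμ,
      id_whiskerRight]
  have h₂ : (tensorμ X₁ (X₂ ⊗ X₃) Y₁ (Y₂ ⊗ Y₃) ≫ (X₁ ⊗ Y₁) ◁ tensorμ X₂ X₃ Y₂ Y₃) ≫
      (X₁ ⊗ Y₁) ◁ tensorδ X₂ X₃ Y₂ Y₃ ≫ tensorδ X₁ (X₂ ⊗ X₃) Y₁ (Y₂ ⊗ Y₃) = 𝟙 _ := by
    rw [Category.assoc, ← whiskerLeft_comp_assoc, tensorμ_tensorδ, whiskerLeft_id,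
      Category.id_comp, tensorμ_tensorδ]
  have h₃ := associator_monoidal X₁ X₂ X₃ Y₁ Y₂ Y₃
  rw [← Category.comp_id (_ ⊗ₘ _), ← h₂, ← Category.assoc (_ ⊗ₘ _), ← h₃]
  rw [← Category.assoc (tensorμ (X₁ ⊗ X₂) X₃ (Y₁ ⊗ Y₂) Y₃), Category.assoc,
    Category.assoc, Category.assoc (tensorμ (X₁ ⊗ X₂) X₃ (Y₁ ⊗ Y₂) Y₃), reassoc_of% h₁]

end Interchange

section StrictMonoidal

open MonoidalCategory

universe v u

variable {C : Type u} [Category.{v} C] [MonoidalCategory C]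
  [Bicategory.Strict (MonoidalSingleObj C)]

theorem strict_tensorObj_assoc (X Y Z : C) : (X ⊗ Y) ⊗ Z = X ⊗ Y ⊗ Z :=
  Bicategory.Strict.assoc (B := MonoidalSingleObj C) (a := .star C) (b := .star C) (c := .star C)
    (d := .star C) X Y Z

theorem strict_unit_tensorObj (X : C) : 𝟙_ C ⊗ X = X :=
  Bicategory.Strict.id_comp (B := MonoidalSingleObj C) (a := .star C) (b := .star C) X

theorem strict_tensorObj_unit (X : C) : X ⊗ 𝟙_ C = X :=
  Bicategory.Strict.comp_id (B := MonoidalSingleObj C) (a := .star C) (b := .star C) X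

variable {X X' Y Y' Z Z' : C} (f : X ⟶ X') (g : Y ⟶ Y') (h : Z ⟶ Z')

theorem strict_tensorHom_assoc : (f ⊗ₘ g) ⊗ₘ h ≍ f ⊗ₘ g ⊗ₘ h :=
  IsIdentity.heq_of_comp_eq (α_ X Y Z).hom (α_ X' Y' Z').hom (associator_naturality f g h)

theorem strict_unit_tensorHom : 𝟙 (𝟙_ C) ⊗ₘ f ≍ f :=
  IsIdentity.heq_of_comp_eq (λ_ X).hom (λ_ X').hom (by simp)

theorem strict_tensorHom_unit : f ⊗ₘ 𝟙 (𝟙_ C) ≍ f :=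
  IsIdentity.heq_of_comp_eq (ρ_ X).hom (ρ_ X').hom (by simp)

theorem strict_tensorδ_assoc [BraidedCategory C] (X₁ X₂ X₃ Y₁ Y₂ Y₃ : C) :
    (tensorδ X₁ X₂ Y₁ Y₂ ⊗ₘ 𝟙 (X₃ ⊗ Y₃)) ≫ tensorδ (X₁ ⊗ X₂) X₃ (Y₁ ⊗ Y₂) Y₃ ≍
      (𝟙 (X₁ ⊗ Y₁) ⊗ₘ tensorδ X₂ X₃ Y₂ Y₃) ≫ tensorδ X₁ (X₂ ⊗ X₃) Y₁ (Y₂ ⊗ Y₃) := by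
  rw [tensorHom_id, id_tensorHom]
  exact IsIdentity.heq_of_comp_eq (α_ _ _ _).hom ((α_ _ _ _).hom ⊗ₘ (α_ _ _ _).hom)
    (tensorδ_assoc X₁ X₂ X₃ Y₁ Y₂ Y₃)

end StrictMonoidal

section BraidedStrict

open Bicategory CategoryTheory.Prod MonoidalCategory

variable (C : Type) [Category.{0} C] [MonoidalCategory C] [BraidedCategory C]
  [Bicategory.Strict (MonoidalSingleObj C)]

theorem isCubical_braidedComp : IsCubical (braidedComp C) where
  mapId _ := isIdIso_iff_isIdentity.2
    (inferInstanceAs (IsIdentity (MonoidalCategory.leftUnitor (𝟙_ C)).hom))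
  mapComp_left f g := isIdIso_iff_isIdentity.2
    (inferInstanceAs (IsIdentity (tensorδ (C := C) f (𝟙_ C) g.1 g.2)))
  mapComp_right f g := isIdIso_iff_isIdentity.2
    (inferInstanceAs (IsIdentity (tensorδ (C := C) f.1 f.2 (𝟙_ C) g)))

instance (x : MonoidalSingleObj C × MonoidalSingleObj C) :
    IsIdentity ((braidedComp C).mapId x).hom :=
  isIdIso_iff_isIdentity.1 ((isCubical_braidedComp C).mapId x)

/-- The pseudofunctor that picks out the only 1-cell, the unit of the composition along 0-cells. -/
def braidedUnit : OneBicat.{0} ⥤ᵖ MonoidalSingleObj C where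
  obj _ := .star C
  map _ := 𝟙 (MonoidalSingleObj.star C)
  map₂ _ := 𝟙 _
  mapId _ := Iso.refl _
  mapComp _ _ := (Bicategory.leftUnitor _).symm
  map₂_whisker_left _ _ _ _ := IsIdentity.eq
  map₂_whisker_right _ _ := IsIdentity.eq
  map₂_associator _ _ _ := IsIdentity.eq
  map₂_left_unitor _ := IsIdentity.eq
  map₂_right_unitor _ := IsIdentity.eq

instance (x : OneBicat.{0}) : IsIdentity ((braidedUnit C).mapId x).hom :=
  inferInstanceAs (IsIdentity (𝟙 _))

instance {x y z : OneBicat.{0}} (f : x ⟶ y) (g : y ⟶ z) :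
    IsIdentity ((braidedUnit C).mapComp f g).hom :=
  inferInstanceAs (IsIdentity (Bicategory.leftUnitor (𝟙 (MonoidalSingleObj.star C))).symm.hom)

theorem braidedComp_assoc :
    (prodMap (braidedComp C) (.id (MonoidalSingleObj C))).comp (braidedComp C) =
      (prodAssoc (MonoidalSingleObj C) (MonoidalSingleObj C) (MonoidalSingleObj C)).comp
        ((prodMap (.id (MonoidalSingleObj C)) (braidedComp C)).comp (braidedComp C)) := by
  let G := (prodMap (.id (MonoidalSingleObj C)) (braidedComp C)).comp (braidedComp C)
  refine pseudofunctor_hext (fun _ => rfl)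
    (fun f => heq_of_eq (strict_tensorObj_assoc (C := C) f.1.1 f.1.2 f.2))
    (fun η => strict_tensorHom_assoc (C := C) η.1.1 η.1.2 η.2) (fun {x y z} f g => ?_)
  have h : (((prodAssoc _ _ _).comp G).mapComp f g).hom =
      (G.mapComp (f.1.1 ×ₘ (f.1.2 ×ₘ f.2)) (g.1.1 ×ₘ (g.1.2 ×ₘ g.2))).hom :=
    (congrArg (· ≫ _) (G.map₂_id _)).trans (Category.id_comp _)
  rw [h]
  exact strict_tensorδ_assoc (C := C) f.1.1 f.1.2 f.2 g.1.1 g.1.2 g.2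

theorem braidedUnit_braidedComp :
    (Bicategory.Prod.sectR OneBicat.star (MonoidalSingleObj C)).toPseudofunctor.comp
      ((prodMap (braidedUnit C) (.id (MonoidalSingleObj C))).comp (braidedComp C)) =
      .id (MonoidalSingleObj C) := by
  let S := (Bicategory.Prod.sectR OneBicat.star (MonoidalSingleObj C)).toPseudofunctor
  let P := prodMap (braidedUnit C) (.id (MonoidalSingleObj C))
  refine pseudofunctor_hext (fun _ => rfl)
    (fun f => heq_of_eq (strict_unit_tensorObj (C := C) f))
    (fun {x y f g} η => strict_unit_tensorHom (C := C) η) (fun {x y z} f g => ?_)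
  have : IsIdentity ((braidedComp C).mapComp (P.map (S.map f)) (P.map (S.map g))).hom :=
    (isCubical_braidedComp C).isIdentity_mapComp_of_fst (𝟙 _) (𝟙 _) f g
  have h : IsIdentity ((S.comp (P.comp (braidedComp C))).mapComp f g).hom := inferInstance
  exact IsIdentity.heq (hf := h) (f' := 𝟙 (f ≫ g)) (strict_unit_tensorObj (C := C) _)

theorem braidedComp_braidedUnit :
    (Bicategory.Prod.sectL (MonoidalSingleObj C) OneBicat.star).toPseudofunctor.comp
      ((prodMap (.id (MonoidalSingleObj C)) (braidedUnit C)).comp (braidedComp C)) =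
      .id (MonoidalSingleObj C) := by
  let S := (Bicategory.Prod.sectL (MonoidalSingleObj C) OneBicat.star).toPseudofunctor
  let P := prodMap (.id (MonoidalSingleObj C)) (braidedUnit C)
  refine pseudofunctor_hext (fun _ => rfl)
    (fun f => heq_of_eq (strict_tensorObj_unit (C := C) f))
    (fun {x y f g} η => strict_tensorHom_unit (C := C) η) (fun {x y z} f g => ?_)
  have : IsIdentity ((braidedComp C).mapComp (P.map (S.map f)) (P.map (S.map g))).hom :=
    (isCubical_braidedComp C).isIdentity_mapComp_of_snd f g (𝟙 _) (𝟙 _)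
  have h : IsIdentity ((S.comp (P.comp (braidedComp C))).mapComp f g).hom := inferInstance
  exact IsIdentity.heq (hf := h) (f' := 𝟙 (f ≫ g)) (strict_tensorObj_unit (C := C) _)

/-- Composition, units and constraints of the tricategory with one 0-cell and one 1-cell determined
by a braided strict monoidal category. -/
def braidedTriData : TriData Unit (fun _ _ => MonoidalSingleObj C) where
  comp _ _ _ := braidedComp C
  unit _ := braidedUnit C
  assoc _ _ _ _ := equivOfEq (braidedComp_assoc C)
  left _ _ := equivOfEq (braidedUnit_braidedComp C)
  right _ _ := equivOfEq (braidedComp_braidedUnit C)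

instance : (braidedTriData C).IsGray where
  comp _ _ _ := isCubical_braidedComp C
  unit _ x := isIdIso_iff_isIdentity.2 (inferInstanceAs (IsIdentity ((braidedUnit C).mapId x).hom))
  assoc _ _ _ _ := isIdEquiv_equivOfEq _
  left _ _ := isIdEquiv_equivOfEq _
  right _ _ := isIdEquiv_equivOfEq _

/-- The tricategory with one 0-cell and one 1-cell determined by a braided strict monoidal
category. -/
def braidedTricategory : Tricategory Unit (fun _ _ => MonoidalSingleObj C) :=
  (braidedTriData C).toTriModData.toTricategory

theorem isGray_braidedTricategory : (braidedTricategory C).IsGray :=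
  TriModData.isGray_toTricategory _

end BraidedStrict

namespace Penon

universe u

variable {n k p m : ℕ}

namespace RGSet

variable {A B : RGSet.{u} n}

theorem Composable.s {y x : A.cells (m + 1)} (h : A.Composable k (m + 1) y x) (hk : k < m) :
    A.Composable k m (A.s y) (A.s x) := by
  obtain ⟨m, rfl⟩ := Nat.exists_eq_succ_of_ne_zero (Nat.ne_zero_of_lt hk)
  rw [Composable, if_neg hk.ne] at h
  simpa only [Composable, A.t_s] using h

theorem Composable.t {y x : A.cells (m + 1)} (h : A.Composable k (m + 1) y x) (hk : k < m) :
    A.Composable k m (A.t y) (A.t x) := by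
  obtain ⟨m, rfl⟩ := Nat.exists_eq_succ_of_ne_zero (Nat.ne_zero_of_lt hk)
  rw [Composable, if_neg hk.ne] at h
  simpa only [Composable, A.s_s] using h

theorem i_injective (hm : m < n) : Function.Injective (A.i hm) :=
  Function.LeftInverse.injective (A.s_i hm)

theorem composable_of_idT_eq_idS (hk : k < m) (hm : m ≤ n) {y x : A.cells m}
    (h : A.idT k m hm x = A.idS k m hm y) : A.Composable k m y x := by
  induction m with
  | zero => exact absurd hk (Nat.not_lt_zero k)
  | succ m ih =>
    have h := i_injective hm h
    unfold Composable
    split_ifs at h ⊢ with hkm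
    · exact h
    · exact ih (by omega) _ h

theorem idS_idS (hm : m ≤ n) (x : A.cells m) :
    A.idS k m hm (A.idS k m hm x) = A.idS k m hm x := by
  induction m with
  | zero => rfl
  | succ m ih => simp only [idS]; split_ifs <;> simp only [A.s_i, ih]

theorem idT_idS (hm : m ≤ n) (x : A.cells m) :
    A.idT k m hm (A.idS k m hm x) = A.idS k m hm x := by
  induction m with
  | zero => rfl
  | succ m ih => unfold idS idT; split_ifs <;> simp only [A.t_i, ih]

/-- `A.IsLoop k hm E x`: the `k`-dimensional source and target of the `m`-cell `x` agree, and `E` is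
their identity `m`-cell. -/
structure IsLoop (A : RGSet.{u} n) (k : ℕ) {m : ℕ} (hm : m ≤ n) (E x : A.cells m) : Prop where
  idS : A.idS k m hm x = E
  idT : A.idT k m hm x = E

namespace IsLoop

variable {hm : m ≤ n} {E x y : A.cells m}

theorem self (h : A.IsLoop k hm E x) : A.IsLoop k hm E E where
  idS := h.idS ▸ idS_idS hm x
  idT := h.idS ▸ idT_idS hm x

theorem composable (hk : k < m) (hy : A.IsLoop k hm E y) (hx : A.IsLoop k hm E x) :
    A.Composable k m y x :=
  composable_of_idT_eq_idS hk hm (hx.idT.trans hy.idS.symm)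

theorem map (h : A.IsLoop k hm E x) (f : Hom A B) : B.IsLoop k hm (f.map E) (f.map x) where
  idS := (map_idS f k m hm x).symm.trans (congrArg f.map h.idS)
  idT := (map_idT f k m hm x).symm.trans (congrArg f.map h.idT)

end IsLoop

end RGSet

theorem Magma.parallel_comp_comp (A : Magma.{u} n) {y x : A.cells m} (hyx : A.Parallel m y x)
    (h : A.Composable k m y x) (h' : A.Composable k m x y) :
    A.Parallel m (A.comp k y x h) (A.comp k x y h') := by
  cases m with
  | zero => trivial
  | succ m =>
    obtain rfl | hk := (Nat.lt_succ_iff.1 (lt_of_composable h)).eq_or_lt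
    · constructor
      · rw [A.s_comp_self, A.s_comp_self, hyx.1]
      · rw [A.t_comp_self, A.t_comp_self, hyx.2]
    · constructor
      · rw [A.s_comp hk y x h (h.s hk), A.s_comp hk x y h' (h'.s hk)]
        exact A.comp_congr k hyx.1 hyx.1.symm _ _
      · rw [A.t_comp hk y x h (h.t hk), A.t_comp hk x y h' (h'.t hk)]
        exact A.comp_congr k hyx.2 hyx.2.symm _ _

namespace StrictCat

variable (B : StrictCat.{u} n) {hm : m ≤ n} {E x y : B.cells m}

theorem comp_of_isLoop_right (hx : B.IsLoop k hm E x) (h : B.Composable k m x E) :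
    B.comp k x E h = x := by
  obtain rfl := hx.idS
  exact B.comp_id k hm x h

theorem comp_of_isLoop_left (hx : B.IsLoop k hm E x) (h : B.Composable k m E x) :
    B.comp k E x h = x := by
  obtain rfl := hx.idT
  exact B.id_comp k hm x h

theorem interchange_of_eq (hpk : p < k) {y' y x' x Y X Y' X' : B.cells m}
    {h₁ : B.Composable k m y' y} {h₂ : B.Composable k m x' x} {h₃ : B.Composable p m y' x'}
    {h₄ : B.Composable p m y x} (hY : B.comp k y' y h₁ = Y) (hX : B.comp k x' x h₂ = X)
    (hY' : B.comp p y' x' h₃ = Y') (hX' : B.comp p y x h₄ = X') (hp : B.Composable p m Y X)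
    (hk : B.Composable k m Y' X') : B.comp p Y X hp = B.comp k Y' X' hk := by
  subst hY hX hY' hX'
  exact B.interchange hpk _ _ _ _ _ _ _ _ _ _

theorem comp_eq_comp_of_isLoop (hpk : p < k) (hk : k < m) (hyp : B.IsLoop p hm E y)
    (hyk : B.IsLoop k hm E y) (hxp : B.IsLoop p hm E x) (hxk : B.IsLoop k hm E x)
    (hp : B.Composable p m y x) (h : B.Composable k m y x) :
    B.comp p y x hp = B.comp k y x h :=
  have hpm := hpk.trans hk
  B.interchange_of_eq hpk
    (B.comp_of_isLoop_right hyk (hyk.composable hk hyk.self))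
    (B.comp_of_isLoop_left hxk (hxk.self.composable hk hxk))
    (B.comp_of_isLoop_right hyp (hyp.composable hpm hyp.self))
    (B.comp_of_isLoop_left hxp (hxp.self.composable hpm hxp)) hp h

theorem comp_eq_comp_swap_of_isLoop (hpk : p < k) (hk : k < m) (hyp : B.IsLoop p hm E y)
    (hyk : B.IsLoop k hm E y) (hxp : B.IsLoop p hm E x) (hxk : B.IsLoop k hm E x)
    (hp : B.Composable p m y x) (h : B.Composable k m x y) :
    B.comp p y x hp = B.comp k x y h :=
  have hpm := hpk.trans hk
  B.interchange_of_eq hpk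
    (B.comp_of_isLoop_left hyk (hyk.self.composable hk hyk))
    (B.comp_of_isLoop_right hxk (hxk.composable hk hxk.self))
    (B.comp_of_isLoop_left hxp (hxp.self.composable hpm hxp))
    (B.comp_of_isLoop_right hyp (hyp.composable hpm hyp.self)) hp h

theorem comp_comm_of_isLoop (hpk : p < k) (hk : k < m) (hyp : B.IsLoop p hm E y)
    (hyk : B.IsLoop k hm E y) (hxp : B.IsLoop p hm E x) (hxk : B.IsLoop k hm E x)
    (h : B.Composable k m y x) (h' : B.Composable k m x y) : B.comp k y x h = B.comp k x y h' :=
  have hp := hyp.composable (hpk.trans hk) hxp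
  (B.comp_eq_comp_of_isLoop hpk hk hyp hyk hxp hxk hp h).symm.trans
    (B.comp_eq_comp_swap_of_isLoop hpk hk hyp hyk hxp hxk hp h')

end StrictCat

theorem Q.comp_comm_of_isLoop (D : Q.{u} n) (hpk : p < k) {E x y : D.A.cells n}
    (hyx : D.A.Parallel n y x) (hyp : D.A.IsLoop p le_rfl E y) (hyk : D.A.IsLoop k le_rfl E y)
    (hxp : D.A.IsLoop p le_rfl E x) (hxk : D.A.IsLoop k le_rfl E x)
    (h : D.A.Composable k n y x) (h' : D.A.Composable k n x y) :
    D.A.comp k y x h = D.A.comp k x y h' := by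
  refine D.con.eq_of_top _ _ (D.A.parallel_comp_comp hyx h h') ?_
  rw [D.f.map_comp, D.f.map_comp]
  exact D.B.comp_comm_of_isLoop hpk (lt_of_composable h) (hyp.map _) (hyk.map _) (hxp.map _)
    (hxk.map _) _ _

theorem algComp_comm_of_isLoop (X : (monad.{u} n).Algebra) (hpk : p < k) {E x y : X.A.cells n}
    (hyx : X.A.Parallel n y x) (hyp : X.A.IsLoop p le_rfl E y) (hyk : X.A.IsLoop k le_rfl E y)
    (hxp : X.A.IsLoop p le_rfl E x) (hxk : X.A.IsLoop k le_rfl E x)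
    (h : X.A.Composable k n y x) (h' : X.A.Composable k n x y) :
    algComp X k y x h = algComp X k x y h' :=
  let η : RGSet.Hom X.A ((Q.forget n).leftAdjoint.obj X.A).A.toRGSet := (monad n).η.app X.A
  congrArg X.a.map (Q.comp_comm_of_isLoop _ hpk (hyx.map η) (hyp.map η) (hyk.map η) (hxp.map η)
    (hxk.map η) _ _)

end Penon

namespace Tricategory

open Bicategory

universe u

variable {Obj : Type u} {Hom : Obj → Obj → Type u} [∀ a b, Bicategory.{u, u} (Hom a b)]

theorem cell₃_injective {a b : Obj} {f g : Hom a b} {α β : f ⟶ g} :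
    Function.Injective (cell₃ (α := α) (β := β)) := by
  intro Φ Ψ h
  cases h
  rfl

variable {T : Tricategory Obj Hom} {a : Obj}

theorem isLoop_one_cell₃ {f : Hom a a} {α : f ⟶ f} (Φ : α ⟶ α) :
    T.toRGSet.IsLoop 1 le_rfl (cell₃ (𝟙 (𝟙 f))) (cell₃ Φ) :=
  ⟨rfl, rfl⟩

theorem isLoop_zero_cell₃ {α : T.I a ⟶ T.I a} (Φ : α ⟶ α) :
    T.toRGSet.IsLoop 0 le_rfl (cell₃ (𝟙 (𝟙 (T.I a)))) (cell₃ Φ) :=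
  ⟨rfl, rfl⟩

theorem PenonPresentation.map_injective {X : (Penon.monad.{u} 3).Algebra}
    (P : T.PenonPresentation X) {m : ℕ} : Function.Injective (P.iso.hom.map (m := m)) :=
  Function.LeftInverse.injective (g := P.iso.inv.map (m := m)) fun x =>
    congrArg (fun f : T.toRGSet ⟶ T.toRGSet => f.map x) P.iso.hom_inv_id

theorem IsPenon.hcomp_comm (hT : T.IsPenon) {α : T.I a ⟶ T.I a} (Φ Ψ : α ⟶ α) :
    Φ ▷ α ≫ α ◁ Ψ = Ψ ▷ α ≫ α ◁ Φ := by
  obtain ⟨X, ⟨P⟩⟩ := hT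
  refine cell₃_injective (P.map_injective (m := 3) ?_)
  rw [P.map_hcomp₃, P.map_hcomp₃]
  have hpar : T.toRGSet.Parallel 3 (cell₃ Ψ) (cell₃ Φ) := ⟨rfl, rfl⟩
  exact Penon.algComp_comm_of_isLoop X zero_lt_one (hpar.map P.iso.hom)
    ((isLoop_zero_cell₃ Ψ).map P.iso.hom) ((isLoop_one_cell₃ Ψ).map P.iso.hom)
    ((isLoop_zero_cell₃ Φ).map P.iso.hom) ((isLoop_one_cell₃ Φ).map P.iso.hom) _ _

end Tricategory

section BraidedPenon

open MonoidalCategory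

theorem whiskerRight_eq_whiskerLeft_of_isPenon {C : Type} [Category.{0} C] [MonoidalCategory C]
    [BraidedCategory C] [Bicategory.Strict (MonoidalSingleObj C)]
    (h : (braidedTricategory C).IsPenon) {X : C} (f : X ⟶ X) : f ▷ X = X ◁ f := by
  have key : f ▷ X ≫ X ◁ 𝟙 X = 𝟙 X ▷ X ≫ X ◁ f := h.hcomp_comm (a := ()) (α := X) f (𝟙 X)
  simpa only [whiskerLeft_id, id_whiskerRight, Category.comp_id, Category.id_comp] using key

end BraidedPenon

namespace BraidGroup

theorem swap_succ_comm {i j : ℕ} (h : i + 2 ≤ j) :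
    Equiv.swap i (i + 1) * Equiv.swap j (j + 1) = Equiv.swap j (j + 1) * Equiv.swap i (i + 1) :=
  (Equiv.Perm.disjoint_swap_swap (by grind)).commute.eq

theorem swap_succ_braid (i : ℕ) :
    Equiv.swap i (i + 1) * Equiv.swap (i + 1) (i + 2) * Equiv.swap i (i + 1) =
      Equiv.swap (i + 1) (i + 2) * Equiv.swap i (i + 1) * Equiv.swap (i + 1) (i + 2) := by
  rw [Equiv.swap_mul_swap_mul_swap (by omega) (by omega), Equiv.swap_comm i (i + 1),
    Equiv.swap_comm (i + 1) (i + 2), Equiv.swap_mul_swap_mul_swap (by omega) (by omega),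
    Equiv.swap_comm]

/-- The permutation underlying a braid, acting on `ℕ` instead of `Fin n` so that `σ i` acts as
`Equiv.swap i (i + 1)` for every `n`. -/
def toPerm (n : ℕ) : BraidGroup n →* Equiv.Perm ℕ :=
  PresentedGroup.toGroup (f := fun i => Equiv.swap i.1 (i.1 + 1)) <| by
    rintro r (⟨i, j, hij⟩ | ⟨i, j, hij⟩) <;>
      simp only [map_mul, map_inv, FreeGroup.lift_apply_of, mul_inv_eq_one]
    · exact swap_succ_comm hij
    · rw [← hij]
      exact swap_succ_braid i.1

variable {n i j : ℕ}

theorem toPerm_σ (h : i + 1 < n) : toPerm n (σ i) = Equiv.swap i (i + 1) := by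
  rw [σ, dif_pos h]
  exact PresentedGroup.toGroup.of _

theorem σ_injective (hi : i + 1 < n) (hj : j + 1 < n) (h : (σ i : BraidGroup n) = σ j) :
    i = j := by
  have : Equiv.swap i (i + 1) i = Equiv.swap j (j + 1) i := by
    rw [← toPerm_σ hi, ← toPerm_σ hj, h]
  rw [Equiv.swap_apply_left, Equiv.swap_apply_def] at this
  grind

end BraidGroup

namespace BraidCat

open MonoidalCategory

theorem braid_eqToHom {m n : BraidCat} (h : m = n) : Hom.braid (eqToHom h) = 1 := by
  subst h
  rfl

instance : Bicategory.Strict (MonoidalSingleObj BraidCat) where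
  id_comp _ := BraidCat.ext (zero_add _)
  comp_id _ := BraidCat.ext (add_zero _)
  assoc _ _ _ := BraidCat.ext (add_assoc _ _ _)
  leftUnitor_eqToIso _ := Iso.ext (hom_ext (braid_eqToHom (BraidCat.ext (zero_add _))).symm)
  rightUnitor_eqToIso _ := Iso.ext (hom_ext (braid_eqToHom (BraidCat.ext (add_zero _))).symm)
  associator_eqToIso _ _ _ :=
    Iso.ext (hom_ext (braid_eqToHom (BraidCat.ext (add_assoc _ _ _))).symm)

theorem exists_whiskerRight_ne_whiskerLeft :
    ∃ (n : BraidCat) (β : n ⟶ n), β ▷ n ≠ n ◁ β := by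
  refine ⟨⟨2⟩, ⟨rfl, BraidGroup.σ 0⟩, fun h => ?_⟩
  have hσ : (BraidGroup.σ 0 : BraidGroup 4) = BraidGroup.σ 2 := by
    have hb := congrArg Hom.braid h
    rw [whiskerRight_braid, whiskerLeft_braid] at hb
    exact (BraidGroup.emb_σ _ one_lt_two).symm.trans (hb.trans (BraidGroup.emb_σ _ one_lt_two))
  exact absurd (BraidGroup.σ_injective (by omega) (by omega) hσ) (by omega)

end BraidCat

theorem mainTheorem3 :
    ∃ T : Tricategory Unit (fun _ _ => MonoidalSingleObj BraidCat),
      T.comp () () () = braidedComp BraidCat ∧ T.IsGray ∧ ¬ T.IsPenon := by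
  obtain ⟨n, β, hβ⟩ := BraidCat.exists_whiskerRight_ne_whiskerLeft
  exact ⟨braidedTricategory BraidCat, rfl, isGray_braidedTricategory BraidCat,
    fun h => hβ (whiskerRight_eq_whiskerLeft_of_isPenon h β)⟩
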